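/- **Corollary (Approximate Policy Ordering).** *Setting.* A sample is $S=(X,Z,A,Y)$ with $(X,U)$ drawn from a fixed law ($U$ unobserved), $Z\sim\pi(\cdot\mid X)$ for an instrument policy $\pi$ (a conditional density with respect to a fixed reference measure), $A\sim\Pr(\cdot\mid X,U,Z)$ and $Y\sim\Pr(\cdot\mid X,U,A)$. Let $f(x,a;\theta)$ be a uniformly bounded prediction model, $\theta_0$ the true parameter, $\theta(D_n)$ an estimator that is a symmetric function of the $n$ samples of a dataset $D_n$, and $\mathbb P_{x,a}$ a fixed evaluation distribution. Let $$\mathrm{MSE}(\theta)=\mathbb E_{(X,A)\sim\mathbb P_{x,a}}\big[(f(X,A;\theta_0)-f(X,A;\theta))^2\big],\qquad L_\pi(n)=\mathbb E_\pi[\mathrm{MSE}(\theta(D_n))],\qquad \alpha_\pi(n)=\sqrt{\mathbb E_\pi[\mathrm{MSE}(\theta(D_n))^2]},$$ where under $\mathbb E_\pi$ the dataset $D_n$ consists of $n$ i.i.d. samples drawn with policy $\pi$. *Estimate.* The data $D_n=\{S_i\}_{i\le n}$ are i.i.d. samples logged under a policy $\beta$. For a target policy $\pi$ put $\rho_\pi(s)=\pi(z\mid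 x)/\beta(z\mid x)$ and $\rho_{\max,\pi}=\sup_s\rho_\pi(s)$, where we assume that $\beta(z\mid x)>0$ whenever $\pi(z\mid x)>0$ and that $\rho_{\max,\pi}<\infty$. Accept $S_i$ if $\xi_i\le\rho_\pi(S_i)/\rho_{\max,\pi}$, with $\xi_i$ i.i.d. uniform on $(0,1)$. Given $M$ held-out i.i.d. pairs $(X_m,A_m)\sim\mathbb P_{x,a}$ (the data, the $\xi_i$ and the held-out pairs are independent), set for a sub-dataset $D_k$ of $k$ accepted samples $$\widehat{\mathrm{MSE}}(\theta(D_k))=\frac1M\sum_{m=1}^M\big(f(X_m,A_m;\theta(D_n))-f(X_m,A_m;\theta(D_k))\big)^2 .$$ The rejection sampling estimate $\mathrm{MSE}^{RS}_k(\pi)$ is $0$ if fewer than $k$ samples are accepted; otherwise it is the average of $\widehat{\mathrm{MSE}}(\theta(D_k))$ over all subsets of $k$ accepted samples (complete variant), or over $B$ such subsets drawn independently and uniformly at random (incomplete variant). The result holds for each of the two variants. *Assumptions.* Fix a family of candidate policies. There are a policy-independent rate $r_n>0$, errors $\epsilon_n\to0$ and real numbers $V_\pi$ with $$|r_nL_\pi(n)-V_\pi|\le\epsilon_n\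 (n\ge1)\qquad\text{and}\qquad r_n\alpha_\pi(n)=O(1)$$ for every candidate $\pi$, and also $r_n\alpha_\beta(n)=O(1)$ for the logging policy $\beta$. The integers $k=k(n)$ satisfy $k\to\infty$, $k/n\to0$ and $r_k^2/r_n\to0$, and $M=M(n)$ and $B=B(n)$ are large enough, in the sense that $n r_k^2/k=O(M)$ and, for the incomplete variant, $n/k=O(B)$. For each $n$ the estimates of all the candidates live on one probability space and may depend on one another in any way (for instance, they may use the same data). *Conclusion.* Let $\hat V_\pi=r_k\,\mathrm{MSE}^{RS}_k(\pi)$. There are constants $C_\pi>0$, which depend neither on $n$ nor on $\delta$, such that with $$\gamma_\pi(n,k)=C_\pi\Big(\epsilon_k^2+\frac kn+\frac{r_k^2}{r_n}+e^{-n/(8\rho_{\max,\pi})}\Big)$$ the following hold. 1. For every candidate policy $\pi$, $\hat V_\pi$ is square integrable, and for all sufficiently large $n$ $$\mathbb E[(\hat V_\pi-V_\pi)^2]\le 2\epsilon_k^2+2r_k^2\,\mathbb E\big[(\mathrm{MSE}^{RS}_k(\pi)-L_\pi(k))^2\big]\le\gamma_\pi(n,k).$$ Moreover $\gamma_\pi(n,k)\to0$,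 so that $\hat V_\pi\to V_\pi$ in $L^2$. 2. Let $\pi_1,\pi_2$ be candidate policies and $\gamma=\max(\gamma_{\pi_1},\gamma_{\pi_2})$. For all $n\ge1$, whenever $\hat V_{\pi_1}<\hat V_{\pi_2}$ (so that the estimate prefers $\pi_1$), $$r_n(L_{\pi_1}(n)-L_{\pi_2}(n))\le 2\Big(\epsilon_n+\max_{\pi\in\{\pi_1,\pi_2\}}|V_\pi-\hat V_\pi|\Big).$$ For all sufficiently large $n$ and all $\delta\in(0,1)$, with probability at least $1-\delta$: $|V_\pi-\hat V_\pi|\le\frac2\delta\sqrt{\gamma(n,k)}$ for both $\pi\in\{\pi_1,\pi_2\}$, and if $\hat V_{\pi_1}<\hat V_{\pi_2}$ then $$r_n(L_{\pi_1}(n)-L_{\pi_2}(n))\le 2\epsilon_n+\frac4\delta\sqrt{\gamma(n,k)}=O\big(\epsilon_n+\delta^{-1}\sqrt{\gamma(n,k)}\big).$$ -/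

import Mathlib

open MeasureTheory ProbabilityTheory Filter Topology Asymptotics

namespace IVPolicy

/-- An observed data point `S = (X, Z, A, Y)`: covariates, instrument, treatment, outcome. -/
abbrev Sample (𝒳 𝒵 𝒜 : Type*) := 𝒳 × 𝒵 × 𝒜 × ℝ

/-- The data-generating process: the joint law of covariates and unobserved confounders, the
conditional law of the treatment given `((X, U), Z)` and that of the outcome given `((X, U), A)`. -/
structure Environment (𝒳 𝒰 𝒵 𝒜 : Type*) [MeasurableSpace 𝒳] [MeasurableSpace 𝒰]
    [MeasurableSpace 𝒵] [MeasurableSpace 𝒜] where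
  covConf : Measure (𝒳 × 𝒰)
  treatment : Kernel ((𝒳 × 𝒰) × 𝒵) 𝒜
  outcome : Kernel ((𝒳 × 𝒰) × 𝒜) ℝ
  isProb_covConf : IsProbabilityMeasure covConf
  isMarkov_treatment : IsMarkovKernel treatment
  isMarkov_outcome : IsMarkovKernel outcome

/-- An instrument-selection policy `π(z | x)`, given by its conditional density with respect to a
reference measure `ν` on the instruments (the counting measure for discrete instruments). -/
structure Policy (𝒳 : Type*) {𝒵 : Type*} [MeasurableSpace 𝒳] [MeasurableSpace 𝒵]
    (ν : Measure 𝒵) where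
  dens : 𝒳 → 𝒵 → ℝ
  measurable_dens : Measurable (fun p : 𝒳 × 𝒵 => dens p.1 p.2)
  dens_nonneg : ∀ x z, 0 ≤ dens x z
  lintegral_dens : ∀ x, ∫⁻ z, ENNReal.ofReal (dens x z) ∂ν = 1

section Laws

variable {𝒳 𝒰 𝒵 𝒜 : Type*} [MeasurableSpace 𝒳] [MeasurableSpace 𝒰] [MeasurableSpace 𝒵]
  [MeasurableSpace 𝒜] {ν : Measure 𝒵} [SFinite ν]

/-- The Markov kernel `x ↦ π(z | x) ν(dz)`. -/
noncomputable def Policy.kernel (π : Policy 𝒳 ν) : Kernel 𝒳 𝒵 :=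
  (Kernel.const 𝒳 ν).withDensity (fun x z => ENNReal.ofReal (π.dens x z))

theorem Policy.kernel_apply (π : Policy 𝒳 ν) (x : 𝒳) :
    π.kernel x = ν.withDensity (fun z => ENNReal.ofReal (π.dens x z)) := by
  have h : Measurable (Function.uncurry fun x z => ENNReal.ofReal (π.dens x z)) :=
    π.measurable_dens.ennreal_ofReal
  rw [Policy.kernel, Kernel.withDensity_apply _ h, Kernel.const_apply]

instance (π : Policy 𝒳 ν) : IsMarkovKernel π.kernel :=
  ⟨fun x => ⟨by
    rw [π.kernel_apply x, withDensity_apply _ MeasurableSet.univ, Measure.restrict_univ,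
      π.lintegral_dens x]⟩⟩

/-- The law of one observation when the instrument is drawn from the policy `π`:
`(X, U) ∼ covConf`, `Z ∼ π(· | X)`, `A ∼ Pr(· | X, U, Z)`, `Y ∼ Pr(· | X, U, A)`, and the
confounder `U` is not observed. -/
noncomputable def sampleLaw (env : Environment 𝒳 𝒰 𝒵 𝒜) (π : Policy 𝒳 ν) :
    Measure (Sample 𝒳 𝒵 𝒜) :=
  (((env.covConf ⊗ₘ (π.kernel.comap Prod.fst measurable_fst)) ⊗ₘ env.treatment) ⊗ₘ
      (env.outcome.comap (fun p : ((𝒳 × 𝒰) × 𝒵) × 𝒜 => (p.1.1, p.2)) (by fun_prop))).map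
    (fun q => (q.1.1.1.1, q.1.1.2, q.1.2, q.2))

instance (env : Environment 𝒳 𝒰 𝒵 𝒜) (π : Policy 𝒳 ν) :
    IsProbabilityMeasure (sampleLaw env π) := by
  have := env.isProb_covConf
  have := env.isMarkov_treatment
  have := env.isMarkov_outcome
  unfold sampleLaw
  exact Measure.isProbabilityMeasure_map (by fun_prop)

/-- The single-sample importance ratio `ρ(s) = π(z | x) / β(z | x)`. -/
noncomputable def ratio (π β : Policy 𝒳 ν) (s : Sample 𝒳 𝒵 𝒜) : ℝ :=
  π.dens s.1 s.2.1 / β.dens s.1 s.2.1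

/-- `ρ_max = sup_s ρ(s)`. The type of treatments `𝒜` is explicit, as it cannot be inferred. -/
noncomputable def ratioMax (𝒜 : Type*) (π β : Policy 𝒳 ν) : ℝ :=
  ⨆ s : Sample 𝒳 𝒵 𝒜, ratio π β s

/-- The indices accepted by rejection sampling: those with `ξ_i ≤ ρ(S_i) / ρ_max`. -/
noncomputable def accepted (π β : Policy 𝒳 ν) {n : ℕ} (S : Fin n → Sample 𝒳 𝒵 𝒜)
    (ξ : Fin n → ℝ) : Finset (Fin n) :=
  open Classical in
  Finset.univ.filter fun i => ξ i ≤ ratio π β (S i) / ratioMax 𝒜 π β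

end Laws

section Estimates

variable {𝒳 𝒰 𝒵 𝒜 Θ : Type*} [MeasurableSpace 𝒳] [MeasurableSpace 𝒰] [MeasurableSpace 𝒵]
  [MeasurableSpace 𝒜] {ν : Measure 𝒵} [SFinite ν]

/-- `MSE(ϑ) = E_{(X, A) ∼ Q} (f(X, A; θ₀) - f(X, A; ϑ))²`. -/
noncomputable def mse (Q : Measure (𝒳 × 𝒜)) (f : Θ → 𝒳 × 𝒜 → ℝ) (θ₀ ϑ : Θ) : ℝ :=
  ∫ p, (f θ₀ p - f ϑ p) ^ 2 ∂Q

/-- `L_π(n) = E_π MSE(θ(D_n))`, with `D_n` made of `n` i.i.d. samples drawn from `π`. -/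
noncomputable def loss (env : Environment 𝒳 𝒰 𝒵 𝒜) (Q : Measure (𝒳 × 𝒜)) (f : Θ → 𝒳 × 𝒜 → ℝ)
    (θ₀ : Θ) (est : (n : ℕ) → (Fin n → Sample 𝒳 𝒵 𝒜) → Θ) (π : Policy 𝒳 ν) (n : ℕ) : ℝ :=
  ∫ D, mse Q f θ₀ (est n D) ∂(Measure.pi fun _ : Fin n => sampleLaw env π)

/-- `α_π(n) = (E_π MSE(θ(D_n))²)^{1/2}`. -/
noncomputable def lossL2 (env : Environment 𝒳 𝒰 𝒵 𝒜) (Q : Measure (𝒳 × 𝒜))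
    (f : Θ → 𝒳 × 𝒜 → ℝ) (θ₀ : Θ) (est : (n : ℕ) → (Fin n → Sample 𝒳 𝒵 𝒜) → Θ)
    (π : Policy 𝒳 ν) (n : ℕ) : ℝ :=
  √(∫ D, mse Q f θ₀ (est n D) ^ 2 ∂(Measure.pi fun _ : Fin n => sampleLaw env π))

/-- The sub-dataset of `S` with index set `t`. -/
def subData {n : ℕ} (S : Fin n → Sample 𝒳 𝒵 𝒜) (t : Finset (Fin n)) :
    Fin t.card → Sample 𝒳 𝒵 𝒜 :=
  fun j => S (t.orderEmbOfFin rfl j)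

/-- The proxy of `MSE(θ(D_t))` for the sub-dataset `D_t`, in which `θ(D_n)` replaces `θ₀` and the
mean over the held-out sample `W` replaces the expectation. -/
noncomputable def proxyMSE (f : Θ → 𝒳 × 𝒜 → ℝ) (est : (n : ℕ) → (Fin n → Sample 𝒳 𝒵 𝒜) → Θ)
    {n M : ℕ} (S : Fin n → Sample 𝒳 𝒵 𝒜) (W : Fin M → 𝒳 × 𝒜) (t : Finset (Fin n)) : ℝ :=
  (M : ℝ)⁻¹ * ∑ j, (f (est n S) (W j) - f (est t.card (subData S t)) (W j)) ^ 2

/-- One run of the rejection sampling procedure for the target policy `π` with `n` samples logged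
under the policy `β`, sub-sample size `k`, `M` held-out samples from `Q` and `B` random subsets,
on a probability space `(Ω, P)`. -/
structure RSRun (env : Environment 𝒳 𝒰 𝒵 𝒜) (Q : Measure (𝒳 × 𝒜)) (β π : Policy 𝒳 ν)
    (n k M B : ℕ) {Ω : Type*} [MeasurableSpace Ω] (P : Measure Ω) where
  /-- the logged dataset `D_n` -/
  data : Ω → Fin n → Sample 𝒳 𝒵 𝒜
  /-- the acceptance variables -/
  unif : Ω → Fin n → ℝ
  /-- the held-out covariates and treatments -/
  heldOut : Ω → Fin M → 𝒳 × 𝒜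
  /-- the index sets of the random sub-samples -/
  draws : Ω → Fin B → Finset (Fin n)
  measurable_data : Measurable data
  measurable_unif : Measurable unif
  measurable_heldOut : Measurable heldOut
  measurableSet_draws : ∀ t, MeasurableSet {ω | draws ω = t}
  /-- The logged samples are i.i.d. from `β`, the acceptance variables are i.i.d. uniform on
  `(0, 1)`, the held-out samples are i.i.d. from `Q`, and the three groups are independent. -/
  law : P.map (fun ω => (data ω, unif ω, heldOut ω)) =
    (Measure.pi fun _ : Fin n => sampleLaw env β).prod
      ((Measure.pi fun _ : Fin n => (volume : Measure ℝ).restrict (Set.Ioo 0 1)).prod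
        (Measure.pi fun _ : Fin M => Q))
  /-- Given all the rest, if the accepted set `a` has at least `k` elements, then the `B` subsets
  are i.i.d. uniform among the `k`-element subsets of `a`. -/
  law_draws : ∀ (E : Set ((Fin n → Sample 𝒳 𝒵 𝒜) × (Fin n → ℝ) × (Fin M → 𝒳 × 𝒜))),
    MeasurableSet E → ∀ a : Finset (Fin n), k ≤ a.card →
    ∀ t : Fin B → Finset (Fin n), (∀ b, t b ∈ a.powersetCard k) →
      P {ω | (data ω, unif ω, heldOut ω) ∈ E ∧ accepted π β (data ω) (unif ω) = a ∧
          draws ω = t} =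
        P {ω | (data ω, unif ω, heldOut ω) ∈ E ∧ accepted π β (data ω) (unif ω) = a} /
          ((a.card.choose k : ENNReal) ^ B)

/-- The complete estimate averages over all `k`-element subsets of the accepted samples, the
incomplete one over `B` random subsets. -/
inductive RSVariant
  | complete
  | incomplete

/-- The rejection sampling estimate of the mean squared error; it is `0` when fewer than `k`
samples are accepted. -/
noncomputable def RSRun.estimate {env : Environment 𝒳 𝒰 𝒵 𝒜} {Q : Measure (𝒳 × 𝒜)}
    {β π : Policy 𝒳 ν} {n k M B : ℕ} {Ω : Type*} [MeasurableSpace Ω] {P : Measure Ω}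
    (R : RSRun env Q β π n k M B P) (f : Θ → 𝒳 × 𝒜 → ℝ)
    (est : (n : ℕ) → (Fin n → Sample 𝒳 𝒵 𝒜) → Θ) (v : RSVariant) (ω : Ω) : ℝ :=
  let a := accepted π β (R.data ω) (R.unif ω)
  if k ≤ a.card then
    match v with
    | .complete => (a.card.choose k : ℝ)⁻¹ *
        ∑ t ∈ a.powersetCard k, proxyMSE f est (R.data ω) (R.heldOut ω) t
    | .incomplete => (B : ℝ)⁻¹ *
        ∑ b, proxyMSE f est (R.data ω) (R.heldOut ω) (R.draws ω b)
  else 0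

end Estimates

/-- `ε_k² + k / n + r_k² / r_n + exp(-n / (8 ρ_max))`. -/
noncomputable def errorRate (r ε : ℕ → ℝ) (k : ℕ → ℕ) (ρmax : ℝ) (n : ℕ) : ℝ :=
  ε (k n) ^ 2 + (k n : ℝ) / n + r (k n) ^ 2 / r n + Real.exp (-(n : ℝ) / (8 * ρmax))

end IVPolicy

/-!
Given the set `a` of accepted indices, the accepted samples are i.i.d. from the target policy `π`
and independent of everything else (`map_restrict_acceptSet`, `map_restrict_accepted_eq`,
`RSRun.map_restrict_acceptEvent`). So the mean square error of the estimate is a sum, over the sets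
`a`, of the acceptance probabilities `acceptWeight` times mean square errors of averages over the
`k`-element subsets of i.i.d. samples from `π`. Four effects contribute to it.

* If all proxies were exact, the complete estimate would be a U-statistic of order `k` in `|a|`
  samples. Averaging over permutations turns it into an average of averages of `⌊|a| / k⌋`
  independent blocks, so that its variance is at most `α_π(k) ^ 2 / ⌊|a| / k⌋`
  (`integral_sq_uStat_le`).
* The number of accepted samples is binomial with mean `n / ρ_max`, and is below half its mean with
  probability at most `exp (-n / (8 ρ_max))` (`sum_bernoulli_lower_tail_le`). On that event the
  error is still of the order of `α_π(k) ^ 2`.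
* Replacing `θ₀` by `θ(D_n)`, and the expectation by a held-out average, costs at most a constant
  times `MSE(θ(D_n)) + 1 / M` in mean square (`integral_sq_proxyMSE_sub_le`). This uses only that
  predictions are bounded. The conditioning on `a` biases the law of `D_n`, but averaging over `a`
  restores the expectation under `β` (`RSRun.sum_acceptWeight_mul_integral`).
* Drawing `B` subsets at random adds a `B`-th of the second moment of the proxies
  (`integral_sq_iid_average_sub_le`, `RSRun.map_restrict_acceptEvent_draws`).

Together they give the finite-sample bound `RSRun.integral_sq_estimate_sub_loss_le`; multiplied by
`r_k ^ 2`, it is of the order of `errorRate` (`exists_eventually_le_errorRate`). The statements on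
the ordering of two policies follow from the approximation of `r_n L_π(n)` by `V_π`, the triangle
inequality and Chebyshev's inequality.
-/

open MeasureTheory ProbabilityTheory Filter Topology Asymptotics

namespace IVPolicy

/-! ### Averages of independent random variables and U-statistics -/

section Averages

/-- The variance of an average of pairwise independent variables with a common mean, in terms of a
bound on their second moments. -/
theorem integral_sq_average_sub_le {κ Ω : Type*} [Fintype κ] [Nonempty κ] [MeasurableSpace Ω]
    {μ : Measure Ω} [IsProbabilityMeasure μ] {X : κ → Ω → ℝ} {m c : ℝ}
    (hX : ∀ i, MemLp (X i) 2 μ) (hm : ∀ i, ∫ ω, X i ω ∂μ = m)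
    (hc : ∀ i, ∫ ω, X i ω ^ 2 ∂μ ≤ c) (hind : Pairwise fun i j => X i ⟂ᵢ[μ] X j) :
    ∫ ω, ((Fintype.card κ : ℝ)⁻¹ * ∑ i, X i ω - m) ^ 2 ∂μ ≤ c / Fintype.card κ := by
  have hpos : (0 : ℝ) < Fintype.card κ := by exact_mod_cast Fintype.card_pos
  have hsum : MemLp (∑ i, X i) 2 μ := memLp_finsetSum' _ fun i _ => hX i
  have hmean : ∫ ω, (∑ i, X i) ω ∂μ = Fintype.card κ * m := by
    simp only [Finset.sum_apply]
    rw [integral_finsetSum _ fun i _ => (hX i).integrable one_le_two]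
    simp [hm]
  have hvar : variance (∑ i, X i) μ ≤ Fintype.card κ * c := by
    rw [IndepFun.variance_sum (fun i _ => hX i) (fun i _ j _ hij => hind hij)]
    calc ∑ i, variance (X i) μ ≤ ∑ _i : κ, c :=
          Finset.sum_le_sum fun i _ => (variance_le_expectation_sq (hX i).1).trans (hc i)
      _ = Fintype.card κ * c := by simp
  rw [variance_eq_integral hsum.aemeasurable, hmean] at hvar
  have heq : ∀ ω, ((Fintype.card κ : ℝ)⁻¹ * ∑ i, X i ω - m) ^ 2 =
      ((Fintype.card κ : ℝ)⁻¹) ^ 2 * ((∑ i, X i) ω - Fintype.card κ * m) ^ 2 := by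
    intro ω
    rw [Finset.sum_apply, ← mul_pow, mul_sub, inv_mul_cancel_left₀ hpos.ne']
  simp_rw [heq]
  rw [integral_const_mul]
  calc ((Fintype.card κ : ℝ)⁻¹) ^ 2 * _
      ≤ ((Fintype.card κ : ℝ)⁻¹) ^ 2 * (Fintype.card κ * c) := by gcongr
    _ = c / Fintype.card κ := by field_simp

/-- Jensen's inequality for the square of a finite average. -/
theorem sq_average_le {α : Type*} (s : Finset α) (g : α → ℝ) :
    ((s.card : ℝ)⁻¹ * ∑ i ∈ s, g i) ^ 2 ≤ (s.card : ℝ)⁻¹ * ∑ i ∈ s, g i ^ 2 := by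
  rcases s.eq_empty_or_nonempty with rfl | hs
  · simp
  have hpos : (0 : ℝ) < s.card := by exact_mod_cast hs.card_pos
  rw [mul_pow]
  calc ((s.card : ℝ)⁻¹) ^ 2 * (∑ i ∈ s, g i) ^ 2
      ≤ ((s.card : ℝ)⁻¹) ^ 2 * (s.card * ∑ i ∈ s, g i ^ 2) := by
        gcongr; exact sq_sum_le_card_mul_sum_sq
    _ = _ := by field_simp

/-- The average of `F` over the `k`-element subsets is its average over the images of one fixed
`k`-element subset under all permutations. -/
theorem average_perm_eq_average_powersetCard {α : Type*} [Fintype α] [DecidableEq α] {k : ℕ}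
    (F : Finset α → ℝ) {T : Finset α} (hT : T.card = k) :
    (Fintype.card (Equiv.Perm α) : ℝ)⁻¹ *
        ∑ σ : Equiv.Perm α, F (T.map σ.toEmbedding) =
      ((Fintype.card α).choose k : ℝ)⁻¹ * ∑ t ∈ Finset.univ.powersetCard k, F t := by
  set c := ∑ σ : Equiv.Perm α, F (T.map σ.toEmbedding) with hc
  -- the average over permutations does not depend on the subset
  have h1 : ∀ t ∈ (Finset.univ : Finset α).powersetCard k,
      ∑ σ : Equiv.Perm α, F (t.map σ.toEmbedding) = c := by
    intro t ht
    have htk := (Finset.mem_powersetCard.1 ht).2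
    obtain ⟨τ, hτ⟩ : ∃ τ : Equiv.Perm α, T.map τ.toEmbedding = t := by
      have e : {x // x ∈ T} ≃ {x // x ∈ t} :=
        Fintype.equivOfCardEq (by simp [hT, htk])
      refine ⟨e.extendSubtype, Finset.eq_of_subset_of_card_le ?_ (by simp [hT, htk])⟩
      intro x hx
      obtain ⟨y, hy, rfl⟩ := Finset.mem_map.1 hx
      exact e.extendSubtype_mem y hy
    refine (Finset.sum_congr rfl fun σ _ => ?_).trans
      (Equiv.sum_comp (Equiv.mulRight τ) fun σ => F (T.map σ.toEmbedding))
    rw [← hτ, Finset.map_map]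
    rfl
  -- each permutation permutes the `k`-element subsets
  have h2 : ∀ σ : Equiv.Perm α, ∑ t ∈ (Finset.univ : Finset α).powersetCard k,
      F (t.map σ.toEmbedding) = ∑ t ∈ (Finset.univ : Finset α).powersetCard k, F t := by
    intro σ
    conv_rhs => rw [← Finset.map_univ_equiv σ, Finset.powersetCard_map, Finset.sum_map]
    rfl
  have h3 := Finset.sum_comm (s := (Finset.univ : Finset (Equiv.Perm α)))
    (t := (Finset.univ : Finset α).powersetCard k) (f := fun σ t => F (t.map σ.toEmbedding))
  rw [Finset.sum_congr rfl h1, Finset.sum_congr rfl fun σ _ => h2 σ] at h3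
  simp only [Finset.sum_const, Finset.card_univ, Finset.card_powersetCard, nsmul_eq_mul] at h3
  have hp : (Fintype.card (Equiv.Perm α) : ℝ) ≠ 0 := by exact_mod_cast Fintype.card_ne_zero
  have hq : ((Fintype.card α).choose k : ℝ) ≠ 0 := by
    have : k ≤ Fintype.card α := hT ▸ Finset.card_le_univ T
    exact_mod_cast (Nat.choose_pos this).ne'
  field_simp
  linarith

/-- Hoeffding's variance bound for U-statistics over a whole finite type: the average over the
`k`-element subsets is an average, over permutations, of averages of `⌊card α / k⌋` independent
blocks. -/
theorem integral_sq_uStat_univ_le {α Ω : Type*} [Fintype α] [MeasurableSpace Ω]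
    {μ : Measure Ω} [IsProbabilityMeasure μ] {k : ℕ} (hk : 0 < k) (hkα : k ≤ Fintype.card α)
    {Y : Finset α → Ω → ℝ} {m c : ℝ}
    (hY : ∀ t, t.card = k → MemLp (Y t) 2 μ)
    (hm : ∀ t, t.card = k → ∫ ω, Y t ω ∂μ = m)
    (hc : ∀ t, t.card = k → ∫ ω, Y t ω ^ 2 ∂μ ≤ c)
    (hind : ∀ t t', t.card = k → t'.card = k → Disjoint t t' → Y t ⟂ᵢ[μ] Y t') :
    ∫ ω, (((Fintype.card α).choose k : ℝ)⁻¹ *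
        ∑ t ∈ Finset.univ.powersetCard k, Y t ω - m) ^ 2 ∂μ ≤
      c / (Fintype.card α / k : ℕ) := by
  classical
  set q := Fintype.card α / k
  have hq0 : 0 < q := Nat.div_pos hkα hk
  have : Nonempty (Fin q) := ⟨⟨0, hq0⟩⟩
  obtain ⟨e⟩ : Nonempty (Fin q × Fin k ↪ α) :=
    Function.Embedding.nonempty_of_card_le (by simpa using Nat.div_mul_le_self _ k)
  -- disjoint blocks of size `k`
  let T : Fin q → Finset α := fun b => Finset.univ.map ((Function.Embedding.sectR b _).trans e)
  have hT : ∀ b, (T b).card = k := fun b => by simp [T]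
  have hdisj : ∀ b b', b ≠ b' → Disjoint (T b) (T b') := by
    intro b b' hbb
    rw [Finset.disjoint_left]
    intro x hx hx'
    obtain ⟨j, -, rfl⟩ := Finset.mem_map.1 hx
    obtain ⟨j', -, h⟩ := Finset.mem_map.1 hx'
    have := e.injective h
    exact hbb (Prod.ext_iff.1 this).1.symm
  have hTσ : ∀ (σ : Equiv.Perm α) b, ((T b).map σ.toEmbedding).card = k := fun σ b => by
    rw [Finset.card_map, hT]
  let Z : Equiv.Perm α → Ω → ℝ := fun σ ω =>
    (Fintype.card (Fin q) : ℝ)⁻¹ * ∑ b, Y ((T b).map σ.toEmbedding) ω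
  have hZ2 : ∀ σ, MemLp (fun ω => Z σ ω - m) 2 μ := fun σ =>
    ((memLp_finsetSum _ fun b _ => hY _ (hTσ σ b)).const_mul _).sub (memLp_const m)
  have hZ : ∀ σ, ∫ ω, (Z σ ω - m) ^ 2 ∂μ ≤ c / q := by
    intro σ
    have := integral_sq_average_sub_le (μ := μ) (X := fun b => Y ((T b).map σ.toEmbedding))
      (m := m) (c := c) (fun b => hY _ (hTσ σ b)) (fun b => hm _ (hTσ σ b))
      (fun b => hc _ (hTσ σ b))
      (fun b b' hbb => hind _ _ (hTσ σ b) (hTσ σ b')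
        ((Finset.disjoint_map _).2 (hdisj b b' hbb)))
    simpa [Z] using this
  have hU : ∀ ω, ((Fintype.card α).choose k : ℝ)⁻¹ *
      ∑ t ∈ Finset.univ.powersetCard k, Y t ω - m =
        ((Finset.univ : Finset (Equiv.Perm α)).card : ℝ)⁻¹ * ∑ σ, (Z σ ω - m) := by
    intro ω
    have hp : (Fintype.card (Equiv.Perm α) : ℝ) ≠ 0 := by exact_mod_cast Fintype.card_ne_zero
    have hq' : (q : ℝ) ≠ 0 := by exact_mod_cast hq0.ne'
    simp only [Finset.card_univ, Finset.sum_sub_distrib, Finset.sum_const, nsmul_eq_mul, Z,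
      ← Finset.mul_sum, Fintype.card_fin]
    rw [Finset.sum_comm, mul_sub, inv_mul_cancel_left₀ hp]
    have key : ∀ b, ∑ σ : Equiv.Perm α, Y ((T b).map σ.toEmbedding) ω =
        Fintype.card (Equiv.Perm α) * (((Fintype.card α).choose k : ℝ)⁻¹ *
          ∑ t ∈ Finset.univ.powersetCard k, Y t ω) := fun b => by
      rw [← average_perm_eq_average_powersetCard (fun t => Y t ω) (hT b),
        mul_inv_cancel_left₀ hp]
    rw [Finset.sum_congr rfl fun b _ => key b, Finset.sum_const, Finset.card_univ,
      Fintype.card_fin, nsmul_eq_mul, inv_mul_cancel_left₀ hq', inv_mul_cancel_left₀ hp]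
  have hp : (0 : ℝ) < (Finset.univ : Finset (Equiv.Perm α)).card := by
    exact_mod_cast Finset.card_pos.2 Finset.univ_nonempty
  calc _ = ∫ ω, (((Finset.univ : Finset (Equiv.Perm α)).card : ℝ)⁻¹ *
            ∑ σ, (Z σ ω - m)) ^ 2 ∂μ := by simp_rw [hU]
    _ ≤ ∫ ω, ((Finset.univ : Finset (Equiv.Perm α)).card : ℝ)⁻¹ *
            ∑ σ, (Z σ ω - m) ^ 2 ∂μ := by
        refine integral_mono_of_nonneg (ae_of_all _ fun _ => sq_nonneg _) ?_
          (ae_of_all _ fun ω => sq_average_le _ _)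
        exact (integrable_finsetSum _ fun σ _ => (hZ2 σ).integrable_sq).const_mul _
    _ = ((Finset.univ : Finset (Equiv.Perm α)).card : ℝ)⁻¹ *
            ∑ σ, ∫ ω, (Z σ ω - m) ^ 2 ∂μ := by
        rw [integral_const_mul, integral_finsetSum _ fun σ _ => (hZ2 σ).integrable_sq]
    _ ≤ ((Finset.univ : Finset (Equiv.Perm α)).card : ℝ)⁻¹ *
            ∑ _σ : Equiv.Perm α, c / q := by
        gcongr with σ; exact hZ σ
    _ = c / q := by
        rw [Finset.sum_const, nsmul_eq_mul, inv_mul_cancel_left₀ hp.ne']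

/-- Hoeffding's variance bound for the U-statistic over the `k`-element subsets of a finite set. -/
theorem integral_sq_uStat_le {α Ω : Type*} [MeasurableSpace Ω]
    {μ : Measure Ω} [IsProbabilityMeasure μ] {k : ℕ} (hk : 0 < k) {a : Finset α}
    (hka : k ≤ a.card) {Y : Finset α → Ω → ℝ} {m c : ℝ}
    (hY : ∀ t ∈ a.powersetCard k, MemLp (Y t) 2 μ)
    (hm : ∀ t ∈ a.powersetCard k, ∫ ω, Y t ω ∂μ = m)
    (hc : ∀ t ∈ a.powersetCard k, ∫ ω, Y t ω ^ 2 ∂μ ≤ c)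
    (hind : ∀ t ∈ a.powersetCard k, ∀ t' ∈ a.powersetCard k, Disjoint t t' →
      Y t ⟂ᵢ[μ] Y t') :
    ∫ ω, ((a.card.choose k : ℝ)⁻¹ * ∑ t ∈ a.powersetCard k, Y t ω - m) ^ 2 ∂μ ≤
      c / (a.card / k : ℕ) := by
  let ι : {x // x ∈ a} ↪ α := Function.Embedding.subtype _
  have hmem : ∀ t : Finset {x // x ∈ a}, t.card = k → t.map ι ∈ a.powersetCard k := by
    intro t ht
    refine Finset.mem_powersetCard.2 ⟨?_, by simp [ht]⟩
    intro x hx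
    obtain ⟨y, -, rfl⟩ := Finset.mem_map.1 hx
    exact y.2
  have h := integral_sq_uStat_univ_le (α := {x // x ∈ a}) (μ := μ) hk (by simpa using hka)
    (Y := fun t => Y (t.map ι)) (m := m) (c := c)
    (fun t ht => hY _ (hmem t ht)) (fun t ht => hm _ (hmem t ht))
    (fun t ht => hc _ (hmem t ht))
    (fun t t' ht ht' hd => hind _ (hmem t ht) _ (hmem t' ht') ((Finset.disjoint_map _).2 hd))
  have hsum : ∀ ω, ∑ t ∈ a.powersetCard k, Y t ω =
      ∑ t ∈ (Finset.univ : Finset {x // x ∈ a}).powersetCard k, Y (t.map ι) ω := by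
    intro ω
    have ha : (Finset.univ : Finset {x // x ∈ a}).map ι = a := Finset.attach_map_val
    conv_lhs => rw [← ha, Finset.powersetCard_map, Finset.sum_map]
    rfl
  simp_rw [hsum]
  simpa using h

/-- Averaging over i.i.d. draws: the mean square deviation of a `B`-sample average from `c` exceeds
that of its mean by at most a `B`-th of the second moment. -/
theorem integral_sq_iid_average_sub_le {E κ : Type*} [MeasurableSpace E] [Fintype κ] [Nonempty κ]
    {μ : Measure E} [IsProbabilityMeasure μ] {g : E → ℝ} (hg : MemLp g 2 μ) (c : ℝ) :
    ∫ w, ((Fintype.card κ : ℝ)⁻¹ * ∑ j, g (w j) - c) ^ 2 ∂(Measure.pi fun _ : κ => μ) ≤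
      (∫ x, g x ∂μ - c) ^ 2 + (∫ x, g x ^ 2 ∂μ) / Fintype.card κ := by
  set m := ∫ x, g x ∂μ with hmdef
  have hev : ∀ j : κ, MeasurePreserving (Function.eval j) (Measure.pi fun _ : κ => μ) μ :=
    fun j => measurePreserving_eval (fun _ : κ => μ) j
  have hL : ∀ j : κ, MemLp (fun w : κ → E => g (w j)) 2 (Measure.pi fun _ : κ => μ) :=
    fun j => hg.comp_measurePreserving (hev j)
  have hint : ∀ (j : κ) (h : E → ℝ), AEStronglyMeasurable h μ →
      ∫ w, h (w j) ∂(Measure.pi fun _ : κ => μ) = ∫ x, h x ∂μ := by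
    intro j h hh
    have h' := integral_map (hev j).measurable.aemeasurable
      (f := h) (by rw [(hev j).map_eq]; exact hh)
    rw [(hev j).map_eq] at h'
    exact h'.symm
  have hind : Pairwise fun i j : κ => (fun w : κ → E => g (w i)) ⟂ᵢ[Measure.pi fun _ : κ => μ]
      (fun w : κ → E => g (w j)) := fun i j hij =>
    (iIndepFun_pi (μ := fun _ : κ => μ) (X := fun _ => g)
      fun _ => hg.1.aemeasurable).indepFun hij
  have hmain := integral_sq_average_sub_le (μ := Measure.pi fun _ : κ => μ)
    (X := fun j w => g (w j)) (m := m) (c := ∫ x, g x ^ 2 ∂μ) hL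
    (fun j => hint j g hg.1) (fun j => (hint j (fun x => g x ^ 2) (hg.1.pow 2)).le) hind
  have havg : MemLp (fun w : κ → E => (Fintype.card κ : ℝ)⁻¹ * ∑ j, g (w j)) 2
      (Measure.pi fun _ : κ => μ) := (memLp_finsetSum _ fun j _ => hL j).const_mul _
  have hmean : ∫ w, (Fintype.card κ : ℝ)⁻¹ * ∑ j, g (w j) ∂(Measure.pi fun _ : κ => μ) = m := by
    rw [integral_const_mul, integral_finsetSum _ fun j _ => (hL j).integrable one_le_two]
    simp [hint _ g hg.1, ← hmdef]
  have hdev := havg.sub (memLp_const m)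
  have h1 : Integrable (fun w : κ → E => ((Fintype.card κ : ℝ)⁻¹ * ∑ j, g (w j) - m) ^ 2)
      (Measure.pi fun _ : κ => μ) := hdev.integrable_sq
  have h2 : Integrable (fun w : κ → E =>
      2 * (m - c) * ((Fintype.card κ : ℝ)⁻¹ * ∑ j, g (w j) - m))
      (Measure.pi fun _ : κ => μ) := (hdev.integrable one_le_two).const_mul _
  have heq : ∀ w : κ → E, ((Fintype.card κ : ℝ)⁻¹ * ∑ j, g (w j) - c) ^ 2 =
      ((Fintype.card κ : ℝ)⁻¹ * ∑ j, g (w j) - m) ^ 2 +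
        2 * (m - c) * ((Fintype.card κ : ℝ)⁻¹ * ∑ j, g (w j) - m) + (m - c) ^ 2 := by
    intro w; ring
  simp_rw [heq]
  have h12 : Integrable (fun w : κ → E => ((Fintype.card κ : ℝ)⁻¹ * ∑ j, g (w j) - m) ^ 2 +
      2 * (m - c) * ((Fintype.card κ : ℝ)⁻¹ * ∑ j, g (w j) - m))
      (Measure.pi fun _ : κ => μ) := h1.add h2
  rw [integral_add h12 (integrable_const _), integral_add h1 h2, integral_const_mul,
    integral_sub (havg.integrable one_le_two) (integrable_const _), hmean]
  simp only [integral_const, probReal_univ, one_smul, sub_self, mul_zero, add_zero]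
  linarith

/-- The lower tail of a sum of `n` independent Bernoulli variables of parameter `p`: with
probability at most `exp (-n p / 8)` it is below half its mean. The probability is written as the
sum over the possible sets of successes, and the bound is Markov's inequality for the weight
`2 ^ (-|a|)`. -/
theorem sum_bernoulli_lower_tail_le {α : Type*} [Fintype α] {p : ℝ} (hp0 : 0 ≤ p) (hp1 : p ≤ 1) :
    ∑ a ∈ Finset.univ.filter (fun a : Finset α => (a.card : ℝ) < Fintype.card α * p / 2),
        p ^ a.card * (1 - p) ^ (Fintype.card α - a.card) ≤
      Real.exp (-(Fintype.card α * p / 8)) := by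
  set n := Fintype.card α
  have h1 : ∀ a ∈ Finset.univ.filter (fun a : Finset α => (a.card : ℝ) < n * p / 2),
      p ^ a.card * (1 - p) ^ (n - a.card) ≤
        Real.exp (Real.log 2 * (n * p / 2)) *
          ((p / 2) ^ a.card * (1 - p) ^ (n - a.card)) := by
    intro a ha
    have hlt := (Finset.mem_filter.1 ha).2
    have hlog : 0 < Real.log 2 := Real.log_pos (by norm_num)
    have h2 : (2 : ℝ) ^ a.card ≤ Real.exp (Real.log 2 * (n * p / 2)) := by
      rw [← Real.rpow_natCast, Real.rpow_def_of_pos (by norm_num)]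
      gcongr
    calc p ^ a.card * (1 - p) ^ (n - a.card)
        = 2 ^ a.card * ((p / 2) ^ a.card * (1 - p) ^ (n - a.card)) := by
          rw [div_pow]; field_simp
      _ ≤ _ := by
          gcongr
  have hlog2 : Real.log 2 < 0.7 := by linarith [Real.log_two_lt_d9]
  -- the exponent is `n p (log 2 - 1) / 2`, and `(1 - log 2) / 2 > 1 / 8`
  calc _ ≤ ∑ a ∈ Finset.univ.filter (fun a : Finset α => (a.card : ℝ) < n * p / 2),
          Real.exp (Real.log 2 * (n * p / 2)) *
            ((p / 2) ^ a.card * (1 - p) ^ (n - a.card)) := Finset.sum_le_sum h1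
    _ ≤ ∑ a : Finset α, Real.exp (Real.log 2 * (n * p / 2)) *
            ((p / 2) ^ a.card * (1 - p) ^ (n - a.card)) := by
        refine Finset.sum_le_sum_of_subset_of_nonneg (Finset.filter_subset _ _) fun a _ _ => ?_
        exact mul_nonneg (Real.exp_nonneg _)
          (mul_nonneg (pow_nonneg (by linarith) _) (pow_nonneg (by linarith) _))
    _ = Real.exp (Real.log 2 * (n * p / 2)) * (p / 2 + (1 - p)) ^ n := by
        rw [← Finset.mul_sum, Fintype.sum_pow_mul_eq_add_pow]
    _ ≤ Real.exp (Real.log 2 * (n * p / 2)) * Real.exp (-(p / 2)) ^ n := by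
        have := Real.add_one_le_exp (-(p / 2))
        have h0 : 0 ≤ p / 2 + (1 - p) := by linarith
        gcongr
        linarith
    _ = Real.exp (Real.log 2 * (n * p / 2) + n * (-(p / 2))) := by
        rw [← Real.exp_nat_mul, ← Real.exp_add]
    _ ≤ Real.exp (-(n * p / 8)) := by
        have : 0 ≤ (n : ℝ) * p := by positivity
        gcongr
        nlinarith

end Averages

/-! ### The law of the accepted samples -/

section Ratio

variable {𝒳 𝒵 𝒜 : Type*} [MeasurableSpace 𝒳] [MeasurableSpace 𝒵] {ν : Measure 𝒵}

theorem measurable_ratio [MeasurableSpace 𝒜] (π β : Policy 𝒳 ν) :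
    Measurable (ratio π β : Sample 𝒳 𝒵 𝒜 → ℝ) :=
  (π.measurable_dens.comp (measurable_fst.prodMk (measurable_fst.comp measurable_snd))).div
    (β.measurable_dens.comp (measurable_fst.prodMk (measurable_fst.comp measurable_snd)))

theorem ratio_le_ratioMax {π β : Policy 𝒳 ν}
    (hρ : BddAbove (Set.range (ratio π β : Sample 𝒳 𝒵 𝒜 → ℝ))) (s : Sample 𝒳 𝒵 𝒜) :
    ratio π β s ≤ ratioMax 𝒜 π β :=
  le_ciSup hρ s

/-- The pairs (sample, acceptance variable) for which the sample is accepted. -/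
def acceptSet (π β : Policy 𝒳 ν) : Set (Sample 𝒳 𝒵 𝒜 × ℝ) :=
  {q | q.2 ≤ ratio π β q.1 / ratioMax 𝒜 π β}

theorem accepted_eq_iff (π β : Policy 𝒳 ν) {n : ℕ} (S : Fin n → Sample 𝒳 𝒵 𝒜) (ξ : Fin n → ℝ)
    (a : Finset (Fin n)) :
    accepted π β S ξ = a ↔ ∀ i, (S i, ξ i) ∈ acceptSet π β ↔ i ∈ a := by
  rw [Finset.ext_iff]
  simp [accepted, acceptSet]

theorem measurableSet_acceptSet [MeasurableSpace 𝒜] (π β : Policy 𝒳 ν) :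
    MeasurableSet (acceptSet π β : Set (Sample 𝒳 𝒵 𝒜 × ℝ)) :=
  measurableSet_le measurable_snd (((measurable_ratio π β).comp measurable_fst).div_const _)

theorem measurable_pair_pi {E : Type*} [MeasurableSpace E] (n : ℕ) :
    Measurable fun q : (Fin n → E) × (Fin n → ℝ) => fun i => (q.1 i, q.2 i) := by
  fun_prop

theorem measurableSet_accepted_eq [MeasurableSpace 𝒜] (π β : Policy 𝒳 ν) {n : ℕ}
    (a : Finset (Fin n)) :
    MeasurableSet {q : (Fin n → Sample 𝒳 𝒵 𝒜) × (Fin n → ℝ) | accepted π β q.1 q.2 = a} := by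
  classical
  have h : {q : (Fin n → Sample 𝒳 𝒵 𝒜) × (Fin n → ℝ) | accepted π β q.1 q.2 = a} =
      (fun q : (Fin n → Sample 𝒳 𝒵 𝒜) × (Fin n → ℝ) => fun i => (q.1 i, q.2 i)) ⁻¹'
        Set.univ.pi fun i => if i ∈ a then acceptSet π β else (acceptSet π β)ᶜ := by
    ext q
    simp only [Set.mem_ofPred_eq, accepted_eq_iff, Set.mem_preimage, Set.mem_pi, Set.mem_univ,
      true_implies]
    refine forall_congr' fun i => ?_
    by_cases hi : i ∈ a <;> simp [hi]
  rw [h]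
  refine measurable_pair_pi n (MeasurableSet.univ_pi fun i => ?_)
  split_ifs
  · exact measurableSet_acceptSet π β
  · exact (measurableSet_acceptSet π β).compl

end Ratio

section AcceptedLaw

variable {𝒳 𝒰 𝒵 𝒜 : Type*} [MeasurableSpace 𝒳] [MeasurableSpace 𝒰] [MeasurableSpace 𝒵]
  [MeasurableSpace 𝒜] {ν : Measure 𝒵} [SFinite ν]

theorem lintegral_sampleLaw (env : Environment 𝒳 𝒰 𝒵 𝒜) (π : Policy 𝒳 ν)
    {g : Sample 𝒳 𝒵 𝒜 → ENNReal} (hg : Measurable g) :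
    ∫⁻ s, g s ∂(sampleLaw env π) =
      ∫⁻ x, ∫⁻ z, ENNReal.ofReal (π.dens x.1 z) *
        ∫⁻ a, ∫⁻ y, g (x.1, z, a, y) ∂(env.outcome (x, a)) ∂(env.treatment (x, z)) ∂ν
        ∂env.covConf := by
  have := env.isProb_covConf
  have := env.isMarkov_treatment
  have := env.isMarkov_outcome
  have hg1 : Measurable fun q : (((𝒳 × 𝒰) × 𝒵) × 𝒜) × ℝ => g (q.1.1.1.1, q.1.1.2, q.1.2, q.2) :=
    hg.comp (by fun_prop)
  have hg2 : Measurable fun q : ((𝒳 × 𝒰) × 𝒵) × 𝒜 =>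
      ∫⁻ y, g (q.1.1.1, q.1.2, q.2, y) ∂(env.outcome (q.1.1, q.2)) := by
    have h := Measurable.lintegral_kernel_prod_right'
      (κ := env.outcome.comap (fun p : ((𝒳 × 𝒰) × 𝒵) × 𝒜 => (p.1.1, p.2)) (by fun_prop)) hg1
    simpa [Kernel.comap_apply] using h
  have hg3 : Measurable fun q : (𝒳 × 𝒰) × 𝒵 =>
      ∫⁻ a, ∫⁻ y, g (q.1.1, q.2, a, y) ∂(env.outcome (q.1, a)) ∂(env.treatment q) :=
    Measurable.lintegral_kernel_prod_right' (κ := env.treatment) hg2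
  rw [sampleLaw, lintegral_map hg (by fun_prop), Measure.lintegral_compProd hg1]
  simp only [Kernel.comap_apply]
  rw [Measure.lintegral_compProd hg2, Measure.lintegral_compProd hg3]
  refine lintegral_congr fun x => ?_
  rw [Kernel.comap_apply, π.kernel_apply, lintegral_withDensity_eq_lintegral_mul₀]
  · rfl
  · exact (π.measurable_dens.ennreal_ofReal.comp measurable_prodMk_left).aemeasurable
  · exact (hg3.comp measurable_prodMk_left).aemeasurable

/-- Change of measure: a sample from `β`, weighted by the importance ratio, has the law of a sample
from `π`. -/
theorem withDensity_ratio (env : Environment 𝒳 𝒰 𝒵 𝒜) {π β : Policy 𝒳 ν}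
    (hsupp : ∀ x z, 0 < π.dens x z → 0 < β.dens x z) :
    (sampleLaw env β).withDensity (fun s => ENNReal.ofReal (ratio π β s)) = sampleLaw env π := by
  have hr : Measurable fun s : Sample 𝒳 𝒵 𝒜 => ENNReal.ofReal (ratio π β s) :=
    (measurable_ratio π β).ennreal_ofReal
  refine Measure.ext_of_lintegral _ fun g hg => ?_
  rw [lintegral_withDensity_eq_lintegral_mul _ hr hg, lintegral_sampleLaw env β (hr.mul hg),
    lintegral_sampleLaw env π hg]
  refine lintegral_congr fun x => lintegral_congr fun z => ?_
  simp only [Pi.mul_apply, ratio]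
  have hmul : ENNReal.ofReal (β.dens x.1 z) * ENNReal.ofReal (π.dens x.1 z / β.dens x.1 z) =
      ENNReal.ofReal (π.dens x.1 z) := by
    rw [← ENNReal.ofReal_mul (β.dens_nonneg _ _)]
    rcases (β.dens_nonneg x.1 z).eq_or_lt with h | h
    · -- both densities vanish here, as `π` is dominated by `β`
      have hπ : π.dens x.1 z = 0 :=
        le_antisymm (not_lt.1 fun hp => (hsupp _ _ hp).ne h) (π.dens_nonneg _ _)
      rw [← h, hπ, zero_mul]
    · rw [mul_div_cancel₀ _ h.ne']
  rw [← hmul, mul_assoc]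
  congr 1
  have h1 : ∀ a, ∫⁻ y, ENNReal.ofReal (π.dens x.1 z / β.dens x.1 z) * g (x.1, z, a, y)
      ∂(env.outcome (x, a)) = ENNReal.ofReal (π.dens x.1 z / β.dens x.1 z) *
        ∫⁻ y, g (x.1, z, a, y) ∂(env.outcome (x, a)) := fun a =>
    lintegral_const_mul' _ _ ENNReal.ofReal_ne_top
  simp_rw [h1]
  exact lintegral_const_mul' _ _ ENNReal.ofReal_ne_top

/-- The ratio has mean one under the logging policy, so its supremum is at least one. -/
theorem one_le_ratioMax (env : Environment 𝒳 𝒰 𝒵 𝒜) {π β : Policy 𝒳 ν}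
    (hsupp : ∀ x z, 0 < π.dens x z → 0 < β.dens x z)
    (hρ : BddAbove (Set.range (ratio π β : Sample 𝒳 𝒵 𝒜 → ℝ))) :
    1 ≤ ratioMax 𝒜 π β := by
  have h1 : (sampleLaw env π) Set.univ = 1 := measure_univ
  rw [← withDensity_ratio env hsupp, withDensity_apply _ MeasurableSet.univ,
    Measure.restrict_univ] at h1
  have h2 : (1 : ENNReal) ≤ ENNReal.ofReal (ratioMax 𝒜 π β) := by
    rw [← h1]
    calc _ ≤ ∫⁻ _s, ENNReal.ofReal (ratioMax 𝒜 π β) ∂(sampleLaw env β) :=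
          lintegral_mono fun s => ENNReal.ofReal_le_ofReal (ratio_le_ratioMax hρ s)
      _ = _ := by simp
  simpa using h2

/-- The law of an acceptance variable: uniform on `(0, 1)`. -/
noncomputable abbrev unifLaw : Measure ℝ := (volume : Measure ℝ).restrict (Set.Ioo 0 1)

instance : IsProbabilityMeasure unifLaw := ⟨by simp [unifLaw]⟩

theorem unifLaw_Iic {c : ℝ} (h1 : c ≤ 1) :
    unifLaw (Set.Iic c) = ENNReal.ofReal c := by
  rw [unifLaw, Measure.restrict_apply measurableSet_Iic]
  refine le_antisymm ?_ ?_
  · calc volume (Set.Iic c ∩ Set.Ioo 0 1) ≤ volume (Set.Ioc 0 c) :=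
          measure_mono fun x hx => ⟨hx.2.1, hx.1⟩
      _ = ENNReal.ofReal c := by simp
  · calc ENNReal.ofReal c = volume (Set.Ioo 0 c) := by simp
      _ ≤ volume (Set.Iic c ∩ Set.Ioo 0 1) :=
          measure_mono fun x hx => ⟨hx.2.le, hx.1, hx.2.trans_le h1⟩

/-- Rejection sampling: on the acceptance event, of probability `1 / ρ_max`, the sample logged
under `β` has the law of a sample from `π`. -/
theorem map_restrict_acceptSet (env : Environment 𝒳 𝒰 𝒵 𝒜) {π β : Policy 𝒳 ν}
    (hsupp : ∀ x z, 0 < π.dens x z → 0 < β.dens x z)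
    (hρ : BddAbove (Set.range (ratio π β : Sample 𝒳 𝒵 𝒜 → ℝ))) :
    (((sampleLaw env β).prod unifLaw).restrict (acceptSet π β)).map Prod.fst =
      ENNReal.ofReal (ratioMax 𝒜 π β)⁻¹ • sampleLaw env π := by
  have hpos : 0 < ratioMax 𝒜 π β := one_pos.trans_le (one_le_ratioMax env hsupp hρ)
  ext E hE
  rw [Measure.map_apply measurable_fst hE, Measure.restrict_apply (measurable_fst hE),
    Measure.prod_apply ((measurable_fst hE).inter (measurableSet_acceptSet π β)),
    ← withDensity_ratio env hsupp, Measure.smul_apply, withDensity_apply _ hE, smul_eq_mul,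
    ← lintegral_const_mul' _ _ ENNReal.ofReal_ne_top, ← lintegral_indicator hE]
  refine lintegral_congr fun s => ?_
  by_cases hs : s ∈ E
  · have h : Prod.mk s ⁻¹' (Prod.fst ⁻¹' E ∩ acceptSet π β) =
        Set.Iic (ratio π β s / ratioMax 𝒜 π β) := by
      ext x; simp [hs, acceptSet]
    rw [h, unifLaw_Iic
      ((div_le_one hpos).2 (ratio_le_ratioMax hρ s)), Set.indicator_of_mem hs,
      ← ENNReal.ofReal_mul (inv_nonneg.2 hpos.le), div_eq_inv_mul]
  · have h : Prod.mk s ⁻¹' (Prod.fst ⁻¹' E ∩ acceptSet π β) = ∅ := by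
      ext x; simp [hs]
    rw [h, measure_empty, Set.indicator_of_notMem hs]

/-- The law of a sample on the rejection event, up to its mass `1 - 1 / ρ_max`. If rejection has
probability zero, any probability measure will do. -/
theorem exists_map_restrict_acceptSet_compl (env : Environment 𝒳 𝒰 𝒵 𝒜) {π β : Policy 𝒳 ν}
    (hsupp : ∀ x z, 0 < π.dens x z → 0 < β.dens x z)
    (hρ : BddAbove (Set.range (ratio π β : Sample 𝒳 𝒵 𝒜 → ℝ))) :
    ∃ rej : Measure (Sample 𝒳 𝒵 𝒜), IsProbabilityMeasure rej ∧
      (((sampleLaw env β).prod unifLaw).restrict (acceptSet π β)ᶜ).map Prod.fst =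
        ENNReal.ofReal (1 - (ratioMax 𝒜 π β)⁻¹) • rej := by
  have hpos : 0 < ratioMax 𝒜 π β := one_pos.trans_le (one_le_ratioMax env hsupp hρ)
  set m := (sampleLaw env β).prod unifLaw
  have hacc : m (acceptSet π β) = ENNReal.ofReal (ratioMax 𝒜 π β)⁻¹ := by
    have h := congrArg (fun μ => μ Set.univ) (map_restrict_acceptSet env hsupp hρ)
    simpa [Measure.map_apply measurable_fst MeasurableSet.univ] using h
  have hrej : m (acceptSet π β)ᶜ = ENNReal.ofReal (1 - (ratioMax 𝒜 π β)⁻¹) := by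
    rw [prob_compl_eq_one_sub (measurableSet_acceptSet π β), hacc,
      ENNReal.ofReal_sub _ (inv_nonneg.2 hpos.le), ENNReal.ofReal_one]
  by_cases h0 : m (acceptSet π β)ᶜ = 0
  · refine ⟨sampleLaw env π, inferInstance, ?_⟩
    rw [Measure.restrict_eq_zero.2 h0, Measure.map_zero, ← hrej, h0, zero_smul]
  · have := cond_isProbabilityMeasure h0
    refine ⟨(m[|(acceptSet π β)ᶜ]).map Prod.fst,
      Measure.isProbabilityMeasure_map measurable_fst.aemeasurable, ?_⟩
    rw [ProbabilityTheory.cond, Measure.map_smul, ← hrej, smul_smul,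
      ENNReal.mul_inv_cancel h0 (measure_ne_top _ _), one_smul]

/-- The probability that a given set `a` of `n` samples is the set of accepted ones. -/
noncomputable def acceptWeight (p : ℝ) (n : ℕ) (a : Finset (Fin n)) : ℝ :=
  p ^ a.card * (1 - p) ^ (n - a.card)

theorem acceptWeight_nonneg {p : ℝ} (h0 : 0 ≤ p) (h1 : p ≤ 1) {n : ℕ} (a : Finset (Fin n)) :
    0 ≤ acceptWeight p n a :=
  mul_nonneg (pow_nonneg h0 _) (pow_nonneg (sub_nonneg.2 h1) _)

theorem sum_acceptWeight (p : ℝ) (n : ℕ) : ∑ a, acceptWeight p n a = 1 := by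
  unfold acceptWeight
  have h := Fintype.sum_pow_mul_eq_add_pow (Fin n) p (1 - p)
  simpa using h

/-- The law of the logged data given that `a` is the set of accepted indices, where `rej` is the law
of a rejected sample: the samples are independent, those with index in `a` are drawn from `π`, and
the others from `rej`. -/
noncomputable def acceptedDataLaw (env : Environment 𝒳 𝒰 𝒵 𝒜) (π : Policy 𝒳 ν)
    (rej : Measure (Sample 𝒳 𝒵 𝒜)) {n : ℕ} (a : Finset (Fin n)) :
    Measure (Fin n → Sample 𝒳 𝒵 𝒜) :=
  Measure.pi fun i => if i ∈ a then sampleLaw env π else rej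

instance isProbabilityMeasure_acceptedDataLaw (env : Environment 𝒳 𝒰 𝒵 𝒜) (π : Policy 𝒳 ν)
    (rej : Measure (Sample 𝒳 𝒵 𝒜)) [IsProbabilityMeasure rej] {n : ℕ} (a : Finset (Fin n)) :
    IsProbabilityMeasure (acceptedDataLaw env π rej a) := by
  have : ∀ i, IsProbabilityMeasure (if i ∈ a then sampleLaw env π else rej) := by
    intro i; split_ifs <;> infer_instance
  unfold acceptedDataLaw
  infer_instance

/-- On the event that `a` is the set of accepted indices, of probability `acceptWeight`, the logged
data follow `acceptedDataLaw`. -/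
theorem map_restrict_accepted_eq (env : Environment 𝒳 𝒰 𝒵 𝒜) {π β : Policy 𝒳 ν}
    (hsupp : ∀ x z, 0 < π.dens x z → 0 < β.dens x z)
    (hρ : BddAbove (Set.range (ratio π β : Sample 𝒳 𝒵 𝒜 → ℝ)))
    {rej : Measure (Sample 𝒳 𝒵 𝒜)} [IsProbabilityMeasure rej]
    (hrej : (((sampleLaw env β).prod unifLaw).restrict (acceptSet π β)ᶜ).map Prod.fst =
        ENNReal.ofReal (1 - (ratioMax 𝒜 π β)⁻¹) • rej) {n : ℕ} (a : Finset (Fin n)) :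
    ((((Measure.pi fun _ : Fin n => sampleLaw env β).prod
        (Measure.pi fun _ : Fin n => unifLaw)).restrict
          {q | accepted π β q.1 q.2 = a}).map Prod.fst) =
      ENNReal.ofReal (acceptWeight (ratioMax 𝒜 π β)⁻¹ n a) • acceptedDataLaw env π rej a := by
  classical
  set p := (ratioMax 𝒜 π β)⁻¹
  have h1ρ := one_le_ratioMax env hsupp hρ
  have hp0 : 0 ≤ p := inv_nonneg.2 (zero_le_one.trans h1ρ)
  have hp1 : p ≤ 1 := inv_le_one_of_one_le₀ h1ρ
  have : ∀ i, IsProbabilityMeasure (if i ∈ a then sampleLaw env π else rej) := by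
    intro i; split_ifs <;> infer_instance
  let w : Fin n → ENNReal := fun i => if i ∈ a then ENNReal.ofReal p else ENNReal.ofReal (1 - p)
  have hw : ∏ i, w i = ENNReal.ofReal (acceptWeight p n a) := by
    simp only [w, Finset.prod_ite, Finset.prod_const]
    rw [acceptWeight, ENNReal.ofReal_mul (pow_nonneg hp0 _), ENNReal.ofReal_pow hp0,
      ENNReal.ofReal_pow (sub_nonneg.2 hp1), Finset.filter_mem_eq_inter, Finset.univ_inter,
      ← Finset.compl_filter, Finset.card_compl, Finset.filter_mem_eq_inter, Finset.univ_inter,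
      Fintype.card_fin]
  have hwfin : ∀ i, w i ≠ ⊤ := by
    intro i; simp only [w]; split_ifs <;> exact ENNReal.ofReal_ne_top
  let lam : Fin n → Measure (Sample 𝒳 𝒵 𝒜) := fun i =>
    w i • (if i ∈ a then sampleLaw env π else rej)
  have : ∀ i, IsFiniteMeasure (lam i) := fun i => Measure.smul_finite _ (hwfin i)
  have hlam : ∀ i, lam i = (((sampleLaw env β).prod unifLaw).restrict
      (if i ∈ a then acceptSet π β else (acceptSet π β)ᶜ)).map Prod.fst := by
    intro i
    by_cases hi : i ∈ a
    · simp only [lam, w, hi, if_true]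
      rw [map_restrict_acceptSet env hsupp hρ]
    · simp only [lam, w, hi, if_false]
      rw [hrej]
  -- both sides are the product of the unnormalized laws of the individual samples
  have h1 : Measure.pi lam =
      ENNReal.ofReal (acceptWeight p n a) • acceptedDataLaw env π rej a := by
    refine Measure.pi_eq fun s _ => ?_
    rw [Measure.smul_apply, acceptedDataLaw, Measure.pi_pi, ← hw, smul_eq_mul,
      ← Finset.prod_mul_distrib]
    rfl
  rw [← h1]
  refine (Measure.pi_eq fun s hs => ?_).symm
  have hmp := measurePreserving_arrowProdEquivProdArrow (Sample 𝒳 𝒵 𝒜) ℝ (Fin n)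
    (fun _ => sampleLaw env β) (fun _ => unifLaw)
  have hset : (Prod.fst ⁻¹' Set.univ.pi s ∩
      {q : (Fin n → Sample 𝒳 𝒵 𝒜) × (Fin n → ℝ) | accepted π β q.1 q.2 = a}) =
      (MeasurableEquiv.arrowProdEquivProdArrow (Sample 𝒳 𝒵 𝒜) ℝ (Fin n)).symm ⁻¹'
        Set.univ.pi fun i => Prod.fst ⁻¹' s i ∩
          (if i ∈ a then acceptSet π β else (acceptSet π β)ᶜ) := by
    ext q
    simp only [Set.mem_inter_iff, Set.mem_ofPred_eq, accepted_eq_iff, Set.mem_preimage, Set.mem_pi,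
      Set.mem_univ, true_implies, ← forall_and]
    refine forall_congr' fun i => ?_
    have hq : (MeasurableEquiv.arrowProdEquivProdArrow (Sample 𝒳 𝒵 𝒜) ℝ (Fin n)).symm q i =
      (q.1 i, q.2 i) := rfl
    rw [hq]
    by_cases hi : i ∈ a <;> simp [hi]
  rw [Measure.map_apply measurable_fst (MeasurableSet.univ_pi hs),
    Measure.restrict_apply (measurable_fst (MeasurableSet.univ_pi hs)), hset,
    hmp.symm.measure_preimage_equiv, Measure.pi_pi]
  refine Finset.prod_congr rfl fun i _ => ?_
  rw [hlam, Measure.map_apply measurable_fst (hs i), Measure.restrict_apply (measurable_fst (hs i))]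

end AcceptedLaw

/-! ### The joint law of the data, the held-out sample and the random subsets -/

section RunLaw

variable {𝒳 𝒰 𝒵 𝒜 : Type*} [MeasurableSpace 𝒳] [MeasurableSpace 𝒰] [MeasurableSpace 𝒵]
  [MeasurableSpace 𝒜] {ν : Measure 𝒵} [SFinite ν] {env : Environment 𝒳 𝒰 𝒵 𝒜}
  {Q : Measure (𝒳 × 𝒜)} {β π : Policy 𝒳 ν} {n k M B : ℕ}
  {Ω : Type*} [MeasurableSpace Ω] {P : Measure Ω}

/-- The event that `a` is the set of accepted indices. -/
def RSRun.acceptEvent (R : RSRun env Q β π n k M B P) (a : Finset (Fin n)) : Set Ω :=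
  {ω | accepted π β (R.data ω) (R.unif ω) = a}

theorem RSRun.measurableSet_acceptEvent (R : RSRun env Q β π n k M B P) (a : Finset (Fin n)) :
    MeasurableSet (R.acceptEvent a) :=
  (R.measurable_data.prodMk R.measurable_unif) (measurableSet_accepted_eq π β a)

theorem RSRun.measurable_draws (R : RSRun env Q β π n k M B P) : Measurable R.draws :=
  measurable_to_countable' fun t => R.measurableSet_draws t

/-- Given the set of accepted indices, the data follow `acceptedDataLaw` and the held-out sample is
independent of the data. -/
theorem RSRun.map_restrict_acceptEvent [IsProbabilityMeasure Q]
    (R : RSRun env Q β π n k M B P)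
    (hsupp : ∀ x z, 0 < π.dens x z → 0 < β.dens x z)
    (hρ : BddAbove (Set.range (ratio π β : Sample 𝒳 𝒵 𝒜 → ℝ)))
    {rej : Measure (Sample 𝒳 𝒵 𝒜)} [IsProbabilityMeasure rej]
    (hrej : (((sampleLaw env β).prod unifLaw).restrict (acceptSet π β)ᶜ).map Prod.fst =
        ENNReal.ofReal (1 - (ratioMax 𝒜 π β)⁻¹) • rej) (a : Finset (Fin n)) :
    (P.restrict (R.acceptEvent a)).map (fun ω => (R.data ω, R.heldOut ω)) =
      (ENNReal.ofReal (acceptWeight (ratioMax 𝒜 π β)⁻¹ n a) • acceptedDataLaw env π rej a).prod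
        (Measure.pi fun _ : Fin M => Q) := by
  set A : Set ((Fin n → Sample 𝒳 𝒵 𝒜) × (Fin n → ℝ)) := {q | accepted π β q.1 q.2 = a} with hA
  have hAm : MeasurableSet A := measurableSet_accepted_eq π β a
  have hX : Measurable fun ω => (R.data ω, R.unif ω, R.heldOut ω) :=
    R.measurable_data.prodMk (R.measurable_unif.prodMk R.measurable_heldOut)
  have hX' : Measurable fun ω => ((R.data ω, R.unif ω), R.heldOut ω) :=
    (R.measurable_data.prodMk R.measurable_unif).prodMk R.measurable_heldOut
  have hlaw : P.map (fun ω => ((R.data ω, R.unif ω), R.heldOut ω)) =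
      ((Measure.pi fun _ : Fin n => sampleLaw env β).prod
        (Measure.pi fun _ : Fin n => unifLaw)).prod (Measure.pi fun _ : Fin M => Q) := by
    have h := congrArg (Measure.map MeasurableEquiv.prodAssoc.symm)
      (R.law.trans Measure.prodAssoc_prod.symm)
    rw [MeasurableEquiv.map_symm_map, Measure.map_map (MeasurableEquiv.measurable _) hX] at h
    exact h
  have hev : R.acceptEvent a =
      (fun ω => ((R.data ω, R.unif ω), R.heldOut ω)) ⁻¹' (A ×ˢ Set.univ) := by
    ext ω; simp [RSRun.acceptEvent, hA]
  have hcomp : (fun ω => (R.data ω, R.heldOut ω)) =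
      Prod.map Prod.fst id ∘ fun ω => ((R.data ω, R.unif ω), R.heldOut ω) := rfl
  rw [hcomp, ← Measure.map_map (measurable_fst.prodMap measurable_id) hX', hev,
    ← Measure.restrict_map hX' (hAm.prod MeasurableSet.univ), hlaw, ← Measure.prod_restrict,
    Measure.restrict_univ, ← Measure.map_prod_map _ _ measurable_fst measurable_id,
    Measure.map_id, map_restrict_accepted_eq env hsupp hρ hrej a]

theorem RSRun.map_data [IsProbabilityMeasure Q] (R : RSRun env Q β π n k M B P) :
    P.map R.data = Measure.pi fun _ : Fin n => sampleLaw env β := by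
  have hX : Measurable fun ω => (R.data ω, R.unif ω, R.heldOut ω) :=
    R.measurable_data.prodMk (R.measurable_unif.prodMk R.measurable_heldOut)
  have hcomp : R.data = Prod.fst ∘ fun ω => (R.data ω, R.unif ω, R.heldOut ω) := rfl
  rw [hcomp, ← Measure.map_map measurable_fst hX, R.law, Measure.map_fst_prod]
  have : IsProbabilityMeasure ((volume : Measure ℝ).restrict (Set.Ioo 0 1)) :=
    inferInstanceAs (IsProbabilityMeasure unifLaw)
  simp

/-- The uniform law on the `k`-element subsets of `a`. -/
noncomputable abbrev uniformSubset (k : ℕ) (a : Finset (Fin n)) : Measure (Finset (Fin n)) :=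
  uniformOn (a.powersetCard k : Set (Finset (Fin n)))

theorem isProbabilityMeasure_uniformSubset {a : Finset (Fin n)} (h : k ≤ a.card) :
    IsProbabilityMeasure (uniformSubset k a) :=
  isProbabilityMeasure_uniformOn (Finset.finite_toSet _) (Finset.powersetCard_nonempty.2 h)

theorem uniformSubset_singleton (k : ℕ) (a t : Finset (Fin n)) :
    uniformSubset k a {t} =
      if t ∈ a.powersetCard k then ((a.card.choose k : ENNReal))⁻¹ else 0 := by
  classical
  rw [uniformSubset, ← Finset.coe_singleton, uniformOn_apply_finset]
  split_ifs with h
  · rw [Finset.inter_singleton_of_mem h, Finset.card_singleton, Finset.card_powersetCard]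
    simp
  · rw [Finset.inter_singleton_of_notMem h]
    simp

theorem integral_uniformSubset (k : ℕ) (a : Finset (Fin n)) (g : Finset (Fin n) → ℝ) :
    ∫ t, g t ∂(uniformSubset k a) = (a.card.choose k : ℝ)⁻¹ * ∑ t ∈ a.powersetCard k, g t := by
  classical
  have : IsFiniteMeasure (uniformSubset k a) :=
    inferInstanceAs (IsFiniteMeasure (ProbabilityTheory.cond _ _))
  rw [integral_fintype .of_finite, Finset.mul_sum]
  simp_rw [measureReal_def, uniformSubset_singleton]
  rw [← Finset.sum_subset (Finset.subset_univ (a.powersetCard k))]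
  · refine Finset.sum_congr rfl fun t ht => ?_
    simp [Finset.mem_powersetCard.1 ht]
  · intro t _ ht
    rw [if_neg ht]; simp

theorem measure_eq_of_singleton_le {α : Type*} [Countable α] [MeasurableSpace α]
    [MeasurableSingletonClass α] {μ η : Measure α} [IsFiniteMeasure μ]
    (h : ∀ x, μ {x} ≤ η {x}) (huniv : μ Set.univ = η Set.univ) : μ = η := by
  refine Measure.eq_of_le_of_measure_univ_eq (Measure.le_iff.2 fun s hs => ?_) huniv
  rw [← Measure.tsum_indicator_apply_singleton μ s hs,
    ← Measure.tsum_indicator_apply_singleton η s hs]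
  exact ENNReal.tsum_le_tsum fun x => Set.indicator_le_indicator (h x)

/-- Given the set `a` of accepted indices, the random subsets are i.i.d. uniform among the
`k`-element subsets of `a`, independently of the data and of the held-out sample. -/
theorem RSRun.map_restrict_acceptEvent_draws [IsProbabilityMeasure P]
    (R : RSRun env Q β π n k M B P) {a : Finset (Fin n)} (ha : k ≤ a.card) :
    (P.restrict (R.acceptEvent a)).map (fun ω => ((R.data ω, R.heldOut ω), R.draws ω)) =
      ((P.restrict (R.acceptEvent a)).map (fun ω => (R.data ω, R.heldOut ω))).prod
        (Measure.pi fun _ : Fin B => uniformSubset k a) := by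
  have hX : Measurable fun ω => (R.data ω, R.heldOut ω) :=
    R.measurable_data.prodMk R.measurable_heldOut
  have := isProbabilityMeasure_uniformSubset ha
  symm
  refine Measure.prod_eq fun E F hE hF => ?_
  have hEm : MeasurableSet ((fun ω => (R.data ω, R.heldOut ω)) ⁻¹' E) := hX hE
  -- for fixed `E`, both sides are measures in `F` on a countable space, of the same total mass
  have key : ((P.restrict (R.acceptEvent a)).restrict
      ((fun ω => (R.data ω, R.heldOut ω)) ⁻¹' E)).map R.draws =
      (P.restrict (R.acceptEvent a)) ((fun ω => (R.data ω, R.heldOut ω)) ⁻¹' E) •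
        Measure.pi fun _ : Fin B => uniformSubset k a := by
    symm
    have hfin : IsFiniteMeasure ((P.restrict (R.acceptEvent a))
        ((fun ω => (R.data ω, R.heldOut ω)) ⁻¹' E) •
          Measure.pi fun _ : Fin B => uniformSubset k a) :=
      Measure.smul_finite _ (measure_ne_top _ _)
    refine measure_eq_of_singleton_le (fun t => ?_) ?_
    · rw [Measure.smul_apply, Measure.pi_singleton, smul_eq_mul]
      simp_rw [uniformSubset_singleton]
      by_cases ht : ∀ b, t b ∈ a.powersetCard k
      · rw [Finset.prod_congr rfl fun b _ => if_pos (ht b), Finset.prod_const, Finset.card_univ,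
          Fintype.card_fin, Measure.map_apply R.measurable_draws (measurableSet_singleton t),
          Measure.restrict_apply (R.measurable_draws (measurableSet_singleton t)),
          Measure.restrict_apply hEm,
          Measure.restrict_apply ((R.measurable_draws (measurableSet_singleton t)).inter hEm)]
        have h := R.law_draws ((fun q => (q.1, q.2.2)) ⁻¹' E)
          ((show Measurable fun q : (Fin n → Sample 𝒳 𝒵 𝒜) × (Fin n → ℝ) × (Fin M → 𝒳 × 𝒜) =>
            (q.1, q.2.2) by fun_prop) hE) a ha t ht
        refine le_of_eq ?_
        have h1 : (fun ω => (R.data ω, R.heldOut ω)) ⁻¹' E ∩ R.acceptEvent a =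
            {ω | (R.data ω, R.unif ω, R.heldOut ω) ∈
              (fun q : (Fin n → Sample 𝒳 𝒵 𝒜) × (Fin n → ℝ) × (Fin M → 𝒳 × 𝒜) =>
                (q.1, q.2.2)) ⁻¹' E ∧ accepted π β (R.data ω) (R.unif ω) = a} := rfl
        have h2 : R.draws ⁻¹' {t} ∩ (fun ω => (R.data ω, R.heldOut ω)) ⁻¹' E ∩ R.acceptEvent a =
            {ω | (R.data ω, R.unif ω, R.heldOut ω) ∈
              (fun q : (Fin n → Sample 𝒳 𝒵 𝒜) × (Fin n → ℝ) × (Fin M → 𝒳 × 𝒜) =>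
                (q.1, q.2.2)) ⁻¹' E ∧ accepted π β (R.data ω) (R.unif ω) = a ∧
                R.draws ω = t} := by
          ext ω
          simp only [Set.mem_inter_iff, Set.mem_preimage, Set.mem_singleton_iff,
            RSRun.acceptEvent, Set.mem_ofPred_eq]
          tauto
        rw [h1, h2, h, ← ENNReal.inv_pow, div_eq_mul_inv]
      · obtain ⟨b, hb⟩ := not_forall.1 ht
        rw [Finset.prod_eq_zero (Finset.mem_univ b) (if_neg hb), mul_zero]
        exact zero_le
    · rw [Measure.smul_apply, measure_univ, smul_eq_mul, mul_one,
        Measure.map_apply R.measurable_draws MeasurableSet.univ]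
      simp
  have hF' := congrArg (fun μ => μ F) key
  simp only [Measure.smul_apply, smul_eq_mul] at hF'
  rw [Measure.map_apply R.measurable_draws hF,
    Measure.restrict_apply (R.measurable_draws hF)] at hF'
  rw [Measure.map_apply (hX.prodMk R.measurable_draws) (hE.prod hF), Measure.map_apply hX hE,
    ← hF']
  congr 1
  ext ω
  simp only [Set.mem_preimage, Set.mem_prod, Set.mem_inter_iff]
  tauto

end RunLaw

/-! ### Prediction errors and their proxies -/

section ProxyBounds

variable {𝒳 𝒵 𝒜 Θ : Type*} {f : Θ → 𝒳 × 𝒜 → ℝ} {K : ℝ}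
  {est : (n : ℕ) → (Fin n → Sample 𝒳 𝒵 𝒜) → Θ}

theorem sq_sub_le_of_bounded {K x y : ℝ} (hx : |x| ≤ K) (hy : |y| ≤ K) :
    (x - y) ^ 2 ≤ 4 * K ^ 2 := by
  have h : |x - y| ≤ 2 * K := (abs_sub x y).trans (by linarith)
  calc (x - y) ^ 2 = |x - y| ^ 2 := (sq_abs _).symm
    _ ≤ (2 * K) ^ 2 := by gcongr
    _ = 4 * K ^ 2 := by ring

theorem proxyMSE_nonneg {n M : ℕ} (S : Fin n → Sample 𝒳 𝒵 𝒜) (W : Fin M → 𝒳 × 𝒜)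
    (t : Finset (Fin n)) : 0 ≤ proxyMSE f est S W t :=
  mul_nonneg (inv_nonneg.2 (Nat.cast_nonneg _)) (Finset.sum_nonneg fun _ _ => sq_nonneg _)

/-- An average of numbers bounded by `c` is at most `c`; `0 ≤ c` accounts for the empty average. -/
theorem average_le {α : Type*} {s : Finset α} {g : α → ℝ} {c : ℝ} (hc : 0 ≤ c)
    (h : ∀ i ∈ s, g i ≤ c) : (s.card : ℝ)⁻¹ * ∑ i ∈ s, g i ≤ c := by
  rcases s.eq_empty_or_nonempty with rfl | hs
  · simpa using hc
  · have hpos : (0 : ℝ) < s.card := by exact_mod_cast hs.card_pos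
    rw [inv_mul_le_iff₀ hpos]
    simpa using Finset.sum_le_sum h

theorem proxyMSE_le (hf : ∀ ϑ p, |f ϑ p| ≤ K) {n M : ℕ} (S : Fin n → Sample 𝒳 𝒵 𝒜)
    (W : Fin M → 𝒳 × 𝒜) (t : Finset (Fin n)) : proxyMSE f est S W t ≤ 4 * K ^ 2 := by
  have h := average_le (s := (Finset.univ : Finset (Fin M)))
    (g := fun j => (f (est n S) (W j) - f (est t.card (subData S t)) (W j)) ^ 2)
    (c := 4 * K ^ 2) (by positivity) fun j _ => sq_sub_le_of_bounded (hf _ _) (hf _ _)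
  simpa [proxyMSE] using h

theorem abs_proxyMSE_le (hf : ∀ ϑ p, |f ϑ p| ≤ K) {n M : ℕ} (S : Fin n → Sample 𝒳 𝒵 𝒜)
    (W : Fin M → 𝒳 × 𝒜) (t : Finset (Fin n)) : |proxyMSE f est S W t| ≤ 4 * K ^ 2 := by
  rw [abs_of_nonneg (proxyMSE_nonneg _ _ _)]
  exact proxyMSE_le hf _ _ _

/-- The complete estimate when `a` is the set of accepted indices. -/
noncomputable def completeAverage {n M : ℕ} (f : Θ → 𝒳 × 𝒜 → ℝ)
    (est : (n : ℕ) → (Fin n → Sample 𝒳 𝒵 𝒜) → Θ) (k : ℕ) (a : Finset (Fin n))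
    (q : (Fin n → Sample 𝒳 𝒵 𝒜) × (Fin M → 𝒳 × 𝒜)) : ℝ :=
  (a.card.choose k : ℝ)⁻¹ * ∑ t ∈ a.powersetCard k, proxyMSE f est q.1 q.2 t

theorem abs_completeAverage_le {n k M : ℕ} (hf : ∀ ϑ p, |f ϑ p| ≤ K) (a : Finset (Fin n))
    (q : (Fin n → Sample 𝒳 𝒵 𝒜) × (Fin M → 𝒳 × 𝒜)) :
    |completeAverage f est k a q| ≤ 4 * K ^ 2 := by
  have h := average_le (s := a.powersetCard k) (g := proxyMSE f est q.1 q.2) (c := 4 * K ^ 2)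
    (by positivity) fun t _ => proxyMSE_le hf _ _ _
  rw [Finset.card_powersetCard] at h
  rw [completeAverage, abs_of_nonneg]
  · exact h
  · exact mul_nonneg (inv_nonneg.2 (Nat.cast_nonneg _))
      (Finset.sum_nonneg fun _ _ => proxyMSE_nonneg _ _ _)

/-- The average of the proxies over the subsets `t b`. -/
noncomputable def drawsAverage {n M B : ℕ} (f : Θ → 𝒳 × 𝒜 → ℝ)
    (est : (n : ℕ) → (Fin n → Sample 𝒳 𝒵 𝒜) → Θ)
    (q : ((Fin n → Sample 𝒳 𝒵 𝒜) × (Fin M → 𝒳 × 𝒜)) × (Fin B → Finset (Fin n))) : ℝ :=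
  (B : ℝ)⁻¹ * ∑ b, proxyMSE f est q.1.1 q.1.2 (q.2 b)

theorem abs_drawsAverage_le {n M B : ℕ} (hf : ∀ ϑ p, |f ϑ p| ≤ K)
    (q : ((Fin n → Sample 𝒳 𝒵 𝒜) × (Fin M → 𝒳 × 𝒜)) × (Fin B → Finset (Fin n))) :
    |drawsAverage f est q| ≤ 4 * K ^ 2 := by
  have h := average_le (s := (Finset.univ : Finset (Fin B)))
    (g := fun b => proxyMSE f est q.1.1 q.1.2 (q.2 b)) (c := 4 * K ^ 2)
    (by positivity) fun t _ => proxyMSE_le hf _ _ _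
  rw [Finset.card_univ, Fintype.card_fin] at h
  rw [drawsAverage, abs_of_nonneg]
  · exact h
  · exact mul_nonneg (inv_nonneg.2 (Nat.cast_nonneg _))
      (Finset.sum_nonneg fun _ _ => proxyMSE_nonneg _ _ _)

end ProxyBounds

section Errors

variable {𝒳 𝒵 𝒜 Θ : Type*} [MeasurableSpace 𝒳] [MeasurableSpace 𝒵]
  [MeasurableSpace 𝒜] {Q : Measure (𝒳 × 𝒜)} {f : Θ → 𝒳 × 𝒜 → ℝ} {θ₀ : Θ} {K : ℝ}
  {est : (n : ℕ) → (Fin n → Sample 𝒳 𝒵 𝒜) → Θ}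

theorem memLp_two_of_bounded {Ω : Type*} [MeasurableSpace Ω] {μ : Measure Ω} [IsFiniteMeasure μ]
    {g : Ω → ℝ} (hg : Measurable g) {c : ℝ} (h : ∀ ω, |g ω| ≤ c) : MemLp g 2 μ :=
  MemLp.of_bound hg.aestronglyMeasurable c (ae_of_all _ h)

theorem integrable_of_bounded {Ω : Type*} [MeasurableSpace Ω] {μ : Measure Ω} [IsFiniteMeasure μ]
    {g : Ω → ℝ} (hg : Measurable g) {c : ℝ} (h : ∀ ω, |g ω| ≤ c) : Integrable g μ :=
  (memLp_two_of_bounded hg h).integrable one_le_two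

theorem sq_integral_le_integral_sq {Ω : Type*} [MeasurableSpace Ω] {μ : Measure Ω}
    [IsProbabilityMeasure μ] {g : Ω → ℝ} (hg : MemLp g 2 μ) :
    (∫ ω, g ω ∂μ) ^ 2 ≤ ∫ ω, g ω ^ 2 ∂μ := by
  have h1 := variance_nonneg g μ
  rw [variance_eq_sub hg] at h1
  simpa using h1

theorem mse_nonneg (ϑ : Θ) : 0 ≤ mse Q f θ₀ ϑ := integral_nonneg fun _ => sq_nonneg _

theorem mse_le [IsProbabilityMeasure Q] (hf : ∀ ϑ p, |f ϑ p| ≤ K) (ϑ : Θ) :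
    mse Q f θ₀ ϑ ≤ 4 * K ^ 2 := by
  calc mse Q f θ₀ ϑ ≤ ∫ _p, 4 * K ^ 2 ∂Q :=
        integral_mono_of_nonneg (ae_of_all _ fun _ => sq_nonneg _) (integrable_const _)
          (ae_of_all _ fun p => sq_sub_le_of_bounded (hf _ p) (hf _ p))
    _ = 4 * K ^ 2 := by simp

/-- Replacing the true parameter by `ϑ₁` in the mean squared error of `ϑ₂` costs, in square, at most
a multiple of the mean squared error of `ϑ₁`. -/
theorem sq_integral_sub_mse_le [IsProbabilityMeasure Q] (hf : ∀ ϑ p, |f ϑ p| ≤ K) {ϑ₁ ϑ₂ : Θ}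
    (h0 : Measurable (f θ₀)) (h1 : Measurable (f ϑ₁)) (h2 : Measurable (f ϑ₂)) :
    (∫ p, (f ϑ₁ p - f ϑ₂ p) ^ 2 ∂Q - mse Q f θ₀ ϑ₂) ^ 2 ≤ 16 * K ^ 2 * mse Q f θ₀ ϑ₁ := by
  have hi : ∀ {g h : 𝒳 × 𝒜 → ℝ}, Measurable g → Measurable h → (∀ p, |g p| ≤ K) →
      (∀ p, |h p| ≤ K) → Integrable (fun p => (g p - h p) ^ 2) Q := fun hg hh bg bh =>
    integrable_of_bounded ((hg.sub hh).pow_const 2) (c := 4 * K ^ 2) fun p => by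
      rw [abs_of_nonneg (sq_nonneg _)]; exact sq_sub_le_of_bounded (bg p) (bh p)
  have hb : ∀ p, |f ϑ₁ p + f θ₀ p - 2 * f ϑ₂ p| ≤ 4 * K := by
    intro p
    have a1 := abs_le.1 (hf ϑ₁ p)
    have a0 := abs_le.1 (hf θ₀ p)
    have a2 := abs_le.1 (hf ϑ₂ p)
    rw [abs_le]
    constructor <;> linarith
  have hb' : ∀ p, ((f ϑ₁ p - f ϑ₂ p) ^ 2 - (f θ₀ p - f ϑ₂ p) ^ 2) ^ 2 ≤
      16 * K ^ 2 * (f θ₀ p - f ϑ₁ p) ^ 2 := by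
    intro p
    have : (f ϑ₁ p - f ϑ₂ p) ^ 2 - (f θ₀ p - f ϑ₂ p) ^ 2 =
        -((f ϑ₁ p + f θ₀ p - 2 * f ϑ₂ p) * (f θ₀ p - f ϑ₁ p)) := by ring
    rw [this, neg_sq, mul_pow]
    gcongr
    calc (f ϑ₁ p + f θ₀ p - 2 * f ϑ₂ p) ^ 2 = |f ϑ₁ p + f θ₀ p - 2 * f ϑ₂ p| ^ 2 :=
          (sq_abs _).symm
      _ ≤ (4 * K) ^ 2 := by gcongr; exact hb p
      _ = 16 * K ^ 2 := by ring
  have hdiff : MemLp (fun p => (f ϑ₁ p - f ϑ₂ p) ^ 2 - (f θ₀ p - f ϑ₂ p) ^ 2) 2 Q := by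
    refine memLp_two_of_bounded (((h1.sub h2).pow_const 2).sub ((h0.sub h2).pow_const 2))
      (c := 4 * K ^ 2) fun p => ?_
    have b1 := sq_sub_le_of_bounded (hf ϑ₁ p) (hf ϑ₂ p)
    have b2 := sq_sub_le_of_bounded (hf θ₀ p) (hf ϑ₂ p)
    rw [abs_le]
    constructor <;> nlinarith [sq_nonneg (f ϑ₁ p - f ϑ₂ p), sq_nonneg (f θ₀ p - f ϑ₂ p)]
  rw [mse, ← integral_sub (hi h1 h2 (hf _) (hf _)) (hi h0 h2 (hf _) (hf _))]
  calc _ ≤ ∫ p, ((f ϑ₁ p - f ϑ₂ p) ^ 2 - (f θ₀ p - f ϑ₂ p) ^ 2) ^ 2 ∂Q :=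
        sq_integral_le_integral_sq hdiff
    _ ≤ ∫ p, 16 * K ^ 2 * (f θ₀ p - f ϑ₁ p) ^ 2 ∂Q :=
        integral_mono hdiff.integrable_sq ((hi h0 h1 (hf _) (hf _)).const_mul _) hb'
    _ = 16 * K ^ 2 * mse Q f θ₀ ϑ₁ := by rw [integral_const_mul, mse]

theorem measurable_subData {n : ℕ} (t : Finset (Fin n)) :
    Measurable fun S : Fin n → Sample 𝒳 𝒵 𝒜 => subData S t :=
  measurable_pi_lambda _ fun _ => measurable_pi_apply _

theorem measurable_apply_est (hest : ∀ n, Measurable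
      fun q : (Fin n → Sample 𝒳 𝒵 𝒜) × (𝒳 × 𝒜) => f (est n q.1) q.2) {n : ℕ}
    (S : Fin n → Sample 𝒳 𝒵 𝒜) : Measurable (f (est n S)) :=
  (hest n).comp measurable_prodMk_left

theorem measurable_mse_est [SFinite Q] (h0 : Measurable (f θ₀)) (hest : ∀ n, Measurable
      fun q : (Fin n → Sample 𝒳 𝒵 𝒜) × (𝒳 × 𝒜) => f (est n q.1) q.2) (n : ℕ) :
    Measurable fun S => mse Q f θ₀ (est n S) := by
  have h : Measurable fun q : (Fin n → Sample 𝒳 𝒵 𝒜) × (𝒳 × 𝒜) =>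
      (f θ₀ q.2 - f (est n q.1) q.2) ^ 2 :=
    ((h0.comp measurable_snd).sub (hest n)).pow_const 2
  exact (StronglyMeasurable.integral_prod_right' h.stronglyMeasurable).measurable

theorem measurable_proxyMSE (hest : ∀ n, Measurable
      fun q : (Fin n → Sample 𝒳 𝒵 𝒜) × (𝒳 × 𝒜) => f (est n q.1) q.2) {n M : ℕ}
    (t : Finset (Fin n)) :
    Measurable fun q : (Fin n → Sample 𝒳 𝒵 𝒜) × (Fin M → 𝒳 × 𝒜) =>
      proxyMSE f est q.1 q.2 t := by
  refine (Finset.measurable_sum _ fun j _ => ?_).const_mul _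
  refine Measurable.pow_const (Measurable.sub ?_ ?_) 2
  · exact (hest n).comp (measurable_fst.prodMk ((measurable_pi_apply j).comp measurable_snd))
  · exact (hest t.card).comp (((measurable_subData t).comp measurable_fst).prodMk
      ((measurable_pi_apply j).comp measurable_snd))

/-- The mean square error of the proxy for fixed data: one term for the plug-in of `θ(D_n)`, and
one for the held-out average. -/
theorem integral_sq_proxyMSE_sub_le [IsProbabilityMeasure Q] (hf : ∀ ϑ p, |f ϑ p| ≤ K)
    (h0 : Measurable (f θ₀)) (hest : ∀ n, Measurable
      fun q : (Fin n → Sample 𝒳 𝒵 𝒜) × (𝒳 × 𝒜) => f (est n q.1) q.2) {n M : ℕ} (hM : 0 < M)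
    (S : Fin n → Sample 𝒳 𝒵 𝒜) (t : Finset (Fin n)) :
    ∫ W, (proxyMSE f est S W t - mse Q f θ₀ (est t.card (subData S t))) ^ 2
        ∂(Measure.pi fun _ : Fin M => Q) ≤
      16 * K ^ 2 * mse Q f θ₀ (est n S) + 16 * K ^ 4 / M := by
  have : Nonempty (Fin M) := ⟨⟨0, hM⟩⟩
  set ϑ₁ := est n S
  set ϑ₂ := est t.card (subData S t)
  have m1 : Measurable (f ϑ₁) := measurable_apply_est hest S
  have m2 : Measurable (f ϑ₂) := measurable_apply_est hest _
  have hb : ∀ p, (f ϑ₁ p - f ϑ₂ p) ^ 2 ≤ 4 * K ^ 2 := fun p =>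
    sq_sub_le_of_bounded (hf _ p) (hf _ p)
  have hL : MemLp (fun p => (f ϑ₁ p - f ϑ₂ p) ^ 2) 2 Q :=
    memLp_two_of_bounded ((m1.sub m2).pow_const 2) (c := 4 * K ^ 2) fun p => by
      rw [abs_of_nonneg (sq_nonneg _)]; exact hb p
  have h := integral_sq_iid_average_sub_le (κ := Fin M) hL (mse Q f θ₀ ϑ₂)
  have h4 : ∫ p, ((f ϑ₁ p - f ϑ₂ p) ^ 2) ^ 2 ∂Q ≤ 16 * K ^ 4 := by
    calc _ ≤ ∫ _p, 16 * K ^ 4 ∂Q := by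
          refine integral_mono hL.integrable_sq (integrable_const _) fun p => ?_
          calc ((f ϑ₁ p - f ϑ₂ p) ^ 2) ^ 2 ≤ (4 * K ^ 2) ^ 2 := by gcongr; exact hb p
            _ = 16 * K ^ 4 := by ring
      _ = 16 * K ^ 4 := by simp
  rw [Fintype.card_fin] at h
  refine h.trans (add_le_add (sq_integral_sub_mse_le hf h0 m1 m2) ?_)
  gcongr

end Errors

/-! ### Errors given the set of accepted samples -/

section Accepted

variable {𝒳 𝒰 𝒵 𝒜 Θ : Type*} [MeasurableSpace 𝒳] [MeasurableSpace 𝒰] [MeasurableSpace 𝒵]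
  [MeasurableSpace 𝒜] {ν : Measure 𝒵} [SFinite ν] {env : Environment 𝒳 𝒰 𝒵 𝒜}
  {Q : Measure (𝒳 × 𝒜)} {π : Policy 𝒳 ν} {f : Θ → 𝒳 × 𝒜 → ℝ} {θ₀ : Θ} {K : ℝ}
  {est : (n : ℕ) → (Fin n → Sample 𝒳 𝒵 𝒜) → Θ}
  {rej : Measure (Sample 𝒳 𝒵 𝒜)} {n k M : ℕ}

/-- The bound on the mean square error, given the set `a` of accepted indices, of the proxy for one
subset: the first term comes from the plug-in of `θ(D_n)`, the second from the held-out average. -/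
noncomputable def proxyError (env : Environment 𝒳 𝒰 𝒵 𝒜) (Q : Measure (𝒳 × 𝒜))
    (π : Policy 𝒳 ν) (f : Θ → 𝒳 × 𝒜 → ℝ) (θ₀ : Θ)
    (est : (n : ℕ) → (Fin n → Sample 𝒳 𝒵 𝒜) → Θ) (rej : Measure (Sample 𝒳 𝒵 𝒜))
    (K : ℝ) (M : ℕ) (a : Finset (Fin n)) : ℝ :=
  16 * K ^ 2 * ∫ S, mse Q f θ₀ (est n S) ∂(acceptedDataLaw env π rej a) + 16 * K ^ 4 / M

theorem proxyError_nonneg (K : ℝ) (M : ℕ) (a : Finset (Fin n)) :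
    0 ≤ proxyError env Q π f θ₀ est rej K M a := by
  have : 0 ≤ ∫ S, mse Q f θ₀ (est n S) ∂(acceptedDataLaw env π rej a) :=
    integral_nonneg fun S => mse_nonneg (est n S)
  unfold proxyError
  positivity

variable [IsProbabilityMeasure rej]

theorem iIndepFun_acceptedDataLaw (a : Finset (Fin n)) :
    iIndepFun (fun i (S : Fin n → Sample 𝒳 𝒵 𝒜) => S i) (acceptedDataLaw env π rej a) := by
  have : ∀ i, IsProbabilityMeasure (if i ∈ a then sampleLaw env π else rej) := by
    intro i; split_ifs <;> infer_instance
  exact iIndepFun_pi (X := fun _ s => s) fun _ => aemeasurable_id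

/-- A sub-dataset of accepted samples is an i.i.d. dataset from the target policy. -/
theorem map_subData_acceptedDataLaw {a t : Finset (Fin n)} (ht : t ⊆ a) :
    (acceptedDataLaw env π rej a).map (fun S => subData S t) =
      Measure.pi fun _ : Fin t.card => sampleLaw env π := by
  have : ∀ i, IsProbabilityMeasure (if i ∈ a then sampleLaw env π else rej) := by
    intro i; split_ifs <;> infer_instance
  have hind := (iIndepFun_acceptedDataLaw (env := env) (π := π) (rej := rej) a).precomp
    (g := t.orderEmbOfFin rfl) (t.orderEmbOfFin rfl).injective
  have h := hind.map_fun_eq_pi_map fun j => (measurable_pi_apply _).aemeasurable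
  refine h.trans ?_
  congr 1
  ext1 j
  have hj : t.orderEmbOfFin rfl j ∈ a := ht (Finset.orderEmbOfFin_mem t rfl j)
  have := (measurePreserving_eval (fun i => if i ∈ a then sampleLaw env π else rej)
    (t.orderEmbOfFin rfl j)).map_eq
  rw [if_pos hj] at this
  exact this

theorem indepFun_subData_acceptedDataLaw (a : Finset (Fin n)) {t t' : Finset (Fin n)}
    (h : Disjoint t t') :
    (fun S : Fin n → Sample 𝒳 𝒵 𝒜 => subData S t) ⟂ᵢ[acceptedDataLaw env π rej a]
      (fun S => subData S t') := by
  have hind := (iIndepFun_acceptedDataLaw (env := env) (π := π) (rej := rej) a).indepFun_finset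
    t t' h fun i => measurable_pi_apply i
  have hm : ∀ s : Finset (Fin n), Measurable fun (D : s → Sample 𝒳 𝒵 𝒜) (j : Fin s.card) =>
      D ⟨s.orderEmbOfFin rfl j, Finset.orderEmbOfFin_mem s rfl j⟩ := fun s =>
    measurable_pi_lambda _ fun j => measurable_pi_apply _
  exact hind.comp (hm t) (hm t')

theorem lossL2_sq (n : ℕ) : lossL2 env Q f θ₀ est π n ^ 2 =
    ∫ D, mse Q f θ₀ (est n D) ^ 2 ∂(Measure.pi fun _ : Fin n => sampleLaw env π) :=
  Real.sq_sqrt (integral_nonneg fun _ => sq_nonneg _)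

theorem lossL2_nonneg (n : ℕ) : 0 ≤ lossL2 env Q f θ₀ est π n := Real.sqrt_nonneg _

variable [IsProbabilityMeasure Q]

theorem memLp_mse_est (hf : ∀ ϑ p, |f ϑ p| ≤ K) (h0 : Measurable (f θ₀)) (hest : ∀ n, Measurable
      fun q : (Fin n → Sample 𝒳 𝒵 𝒜) × (𝒳 × 𝒜) => f (est n q.1) q.2) (n : ℕ)
    {μ : Measure (Fin n → Sample 𝒳 𝒵 𝒜)} [IsFiniteMeasure μ] :
    MemLp (fun S => mse Q f θ₀ (est n S)) 2 μ :=
  memLp_two_of_bounded (measurable_mse_est h0 hest n) (c := 4 * K ^ 2) fun S => by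
    rw [abs_of_nonneg (mse_nonneg _)]; exact mse_le hf _

theorem loss_sq_le (hf : ∀ ϑ p, |f ϑ p| ≤ K) (h0 : Measurable (f θ₀)) (hest : ∀ n, Measurable
      fun q : (Fin n → Sample 𝒳 𝒵 𝒜) × (𝒳 × 𝒜) => f (est n q.1) q.2) (n : ℕ) :
    loss env Q f θ₀ est π n ^ 2 ≤ lossL2 env Q f θ₀ est π n ^ 2 := by
  rw [lossL2_sq]
  exact sq_integral_le_integral_sq (memLp_mse_est hf h0 hest n)

theorem loss_le_lossL2 (hf : ∀ ϑ p, |f ϑ p| ≤ K) (h0 : Measurable (f θ₀)) (hest : ∀ n, Measurable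
      fun q : (Fin n → Sample 𝒳 𝒵 𝒜) × (𝒳 × 𝒜) => f (est n q.1) q.2) (n : ℕ) :
    loss env Q f θ₀ est π n ≤ lossL2 env Q f θ₀ est π n :=
  le_of_sq_le_sq (loss_sq_le hf h0 hest n) (lossL2_nonneg n)

theorem integral_mse_subData {a t : Finset (Fin n)} (ht : t ∈ a.powersetCard k)
    (h0 : Measurable (f θ₀)) (hest : ∀ n, Measurable
      fun q : (Fin n → Sample 𝒳 𝒵 𝒜) × (𝒳 × 𝒜) => f (est n q.1) q.2) :
    ∫ S, mse Q f θ₀ (est t.card (subData S t)) ∂(acceptedDataLaw env π rej a) =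
      loss env Q f θ₀ est π k := by
  obtain ⟨hta, rfl⟩ := Finset.mem_powersetCard.1 ht
  rw [loss, ← map_subData_acceptedDataLaw (rej := rej) hta,
    integral_map (measurable_subData t).aemeasurable]
  exact (measurable_mse_est h0 hest _).aestronglyMeasurable

theorem integral_mse_subData_sq {a t : Finset (Fin n)} (ht : t ∈ a.powersetCard k)
    (h0 : Measurable (f θ₀)) (hest : ∀ n, Measurable
      fun q : (Fin n → Sample 𝒳 𝒵 𝒜) × (𝒳 × 𝒜) => f (est n q.1) q.2) :
    ∫ S, mse Q f θ₀ (est t.card (subData S t)) ^ 2 ∂(acceptedDataLaw env π rej a) =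
      lossL2 env Q f θ₀ est π k ^ 2 := by
  obtain ⟨hta, rfl⟩ := Finset.mem_powersetCard.1 ht
  rw [lossL2_sq, ← map_subData_acceptedDataLaw (rej := rej) hta,
    integral_map (measurable_subData t).aemeasurable]
  exact ((measurable_mse_est h0 hest _).pow_const 2).aestronglyMeasurable

theorem memLp_proxyMSE (hf : ∀ ϑ p, |f ϑ p| ≤ K) (hest : ∀ n, Measurable
      fun q : (Fin n → Sample 𝒳 𝒵 𝒜) × (𝒳 × 𝒜) => f (est n q.1) q.2) (t : Finset (Fin n))
    {μ : Measure ((Fin n → Sample 𝒳 𝒵 𝒜) × (Fin M → 𝒳 × 𝒜))} [IsFiniteMeasure μ] :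
    MemLp (fun q : (Fin n → Sample 𝒳 𝒵 𝒜) × (Fin M → 𝒳 × 𝒜) => proxyMSE f est q.1 q.2 t) 2 μ :=
  memLp_two_of_bounded (measurable_proxyMSE hest t) fun q => abs_proxyMSE_le hf q.1 q.2 t

theorem memLp_mse_subData_fst (hf : ∀ ϑ p, |f ϑ p| ≤ K) (h0 : Measurable (f θ₀))
    (hest : ∀ n, Measurable
      fun q : (Fin n → Sample 𝒳 𝒵 𝒜) × (𝒳 × 𝒜) => f (est n q.1) q.2) (t : Finset (Fin n))
    {μ : Measure ((Fin n → Sample 𝒳 𝒵 𝒜) × (Fin M → 𝒳 × 𝒜))} [IsFiniteMeasure μ] :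
    MemLp (fun q : (Fin n → Sample 𝒳 𝒵 𝒜) × (Fin M → 𝒳 × 𝒜) =>
      mse Q f θ₀ (est t.card (subData q.1 t))) 2 μ :=
  memLp_two_of_bounded
    (((measurable_mse_est h0 hest _).comp (measurable_subData t)).comp measurable_fst)
    (c := 4 * K ^ 2) fun q => by rw [abs_of_nonneg (mse_nonneg _)]; exact mse_le hf _

theorem integral_sq_proxyMSE_sub_mse_le (hf : ∀ ϑ p, |f ϑ p| ≤ K)
    (h0 : Measurable (f θ₀)) (hest : ∀ n, Measurable
      fun q : (Fin n → Sample 𝒳 𝒵 𝒜) × (𝒳 × 𝒜) => f (est n q.1) q.2) (hM : 0 < M)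
    (a t : Finset (Fin n)) :
    ∫ q, (proxyMSE f est q.1 q.2 t - mse Q f θ₀ (est t.card (subData q.1 t))) ^ 2
        ∂((acceptedDataLaw env π rej a).prod (Measure.pi fun _ : Fin M => Q)) ≤
      proxyError env Q π f θ₀ est rej K M a := by
  have hint : Integrable (fun q : (Fin n → Sample 𝒳 𝒵 𝒜) × (Fin M → 𝒳 × 𝒜) =>
      (proxyMSE f est q.1 q.2 t - mse Q f θ₀ (est t.card (subData q.1 t))) ^ 2)
      ((acceptedDataLaw env π rej a).prod (Measure.pi fun _ : Fin M => Q)) :=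
    ((memLp_proxyMSE hf hest t).sub (memLp_mse_subData_fst hf h0 hest t)).integrable_sq
  have hmse : Integrable (fun S => mse Q f θ₀ (est n S)) (acceptedDataLaw env π rej a) :=
    (memLp_mse_est hf h0 hest n).integrable one_le_two
  rw [integral_prod _ hint]
  calc _ ≤ ∫ S, (16 * K ^ 2 * mse Q f θ₀ (est n S) + 16 * K ^ 4 / M)
            ∂(acceptedDataLaw env π rej a) :=
        integral_mono hint.integral_prod_left ((hmse.const_mul _).add (integrable_const _))
          fun S => integral_sq_proxyMSE_sub_le hf h0 hest hM S t
    _ = _ := by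
        rw [integral_add (hmse.const_mul _) (integrable_const _), integral_const_mul]
        simp [proxyError]

theorem measurable_completeAverage (hest : ∀ n, Measurable
      fun q : (Fin n → Sample 𝒳 𝒵 𝒜) × (𝒳 × 𝒜) => f (est n q.1) q.2) (a : Finset (Fin n)) :
    Measurable (completeAverage f est k a (M := M)) :=
  (Finset.measurable_sum _ fun t _ => measurable_proxyMSE hest t).const_mul _

/-- The complete estimate given the set of accepted indices: the variance of a U-statistic of
order `k` and the error of the proxies. -/
theorem integral_sq_completeAverage_sub_loss_le (hf : ∀ ϑ p, |f ϑ p| ≤ K)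
    (h0 : Measurable (f θ₀)) (hest : ∀ n, Measurable
      fun q : (Fin n → Sample 𝒳 𝒵 𝒜) × (𝒳 × 𝒜) => f (est n q.1) q.2) (hM : 0 < M)
    (hk : 0 < k) {a : Finset (Fin n)} (ha : k ≤ a.card) :
    ∫ q, (completeAverage f est k a q - loss env Q f θ₀ est π k) ^ 2
        ∂((acceptedDataLaw env π rej a).prod (Measure.pi fun _ : Fin M => Q)) ≤
      2 * proxyError env Q π f θ₀ est rej K M a +
        2 * (lossL2 env Q f θ₀ est π k ^ 2 / (a.card / k : ℕ)) := by
  set μ := (acceptedDataLaw env π rej a).prod (Measure.pi fun _ : Fin M => Q)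
  set c := (a.card.choose k : ℝ)⁻¹ with hc
  have hcard : ((a.powersetCard k).card : ℝ)⁻¹ = c := by rw [Finset.card_powersetCard]
  set L := loss env Q f θ₀ est π k
  let Y : Finset (Fin n) → (Fin n → Sample 𝒳 𝒵 𝒜) → ℝ := fun t S =>
    mse Q f θ₀ (est t.card (subData S t))
  let U : (Fin n → Sample 𝒳 𝒵 𝒜) → ℝ := fun S => c * ∑ t ∈ a.powersetCard k, Y t S
  have hY : ∀ t, MemLp (Y t) 2 (acceptedDataLaw env π rej a) := fun t =>
    memLp_two_of_bounded ((measurable_mse_est h0 hest _).comp (measurable_subData t))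
      (c := 4 * K ^ 2) fun q => by
        simp only [Y]; rw [abs_of_nonneg (mse_nonneg _)]; exact mse_le hf _
  have hU : ∫ S, (U S - L) ^ 2 ∂(acceptedDataLaw env π rej a) ≤
      lossL2 env Q f θ₀ est π k ^ 2 / (a.card / k : ℕ) :=
    integral_sq_uStat_le hk ha (fun t _ => hY t)
      (fun t ht => integral_mse_subData ht h0 hest)
      (fun t ht => (integral_mse_subData_sq ht h0 hest).le)
      (fun t _ t' _ hd => (indepFun_subData_acceptedDataLaw a hd).comp
        (measurable_mse_est h0 hest _) (measurable_mse_est h0 hest _))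
  have hUL : MemLp (fun S => U S - L) 2 (acceptedDataLaw env π rej a) :=
    ((memLp_finsetSum _ fun t _ => hY t).const_mul _).sub (memLp_const _)
  have hUint : Integrable (fun q : (Fin n → Sample 𝒳 𝒵 𝒜) × (Fin M → 𝒳 × 𝒜) =>
      (U q.1 - L) ^ 2) μ := hUL.integrable_sq.comp_fst _
  have hE : ∀ t, Integrable (fun q : (Fin n → Sample 𝒳 𝒵 𝒜) × (Fin M → 𝒳 × 𝒜) =>
      (proxyMSE f est q.1 q.2 t - Y t q.1) ^ 2) μ := fun t =>
    ((memLp_proxyMSE hf hest t).sub (memLp_mse_subData_fst hf h0 hest t)).integrable_sq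
  have hEsum : Integrable (fun q : (Fin n → Sample 𝒳 𝒵 𝒜) × (Fin M → 𝒳 × 𝒜) =>
      c * ∑ t ∈ a.powersetCard k, (proxyMSE f est q.1 q.2 t - Y t q.1) ^ 2) μ :=
    (integrable_finsetSum _ fun t _ => hE t).const_mul _
  have hpt : ∀ q : (Fin n → Sample 𝒳 𝒵 𝒜) × (Fin M → 𝒳 × 𝒜),
      (completeAverage f est k a q - L) ^ 2 ≤
        2 * (c * ∑ t ∈ a.powersetCard k, (proxyMSE f est q.1 q.2 t - Y t q.1) ^ 2) +
          2 * (U q.1 - L) ^ 2 := by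
    intro q
    have h1 := sq_average_le (a.powersetCard k) fun t => proxyMSE f est q.1 q.2 t - Y t q.1
    rw [hcard] at h1
    have h2 : completeAverage f est k a q - L =
        c * ∑ t ∈ a.powersetCard k, (proxyMSE f est q.1 q.2 t - Y t q.1) + (U q.1 - L) := by
      rw [Finset.sum_sub_distrib]
      simp only [completeAverage, U, ← hc]
      ring
    rw [h2]
    refine add_sq_le.trans ?_
    linarith
  have hprox : ∫ q, c * ∑ t ∈ a.powersetCard k, (proxyMSE f est q.1 q.2 t - Y t q.1) ^ 2 ∂μ ≤
      proxyError env Q π f θ₀ est rej K M a := by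
    rw [integral_const_mul, integral_finsetSum _ fun t _ => hE t, ← hcard]
    have hnn : 0 ≤ proxyError env Q π f θ₀ est rej K M a := proxyError_nonneg K M a
    exact average_le hnn fun t _ => integral_sq_proxyMSE_sub_mse_le hf h0 hest hM a t
  calc _ ≤ ∫ q, (2 * (c * ∑ t ∈ a.powersetCard k, (proxyMSE f est q.1 q.2 t - Y t q.1) ^ 2) +
          2 * (U q.1 - L) ^ 2) ∂μ :=
        integral_mono_of_nonneg (ae_of_all _ fun _ => sq_nonneg _)
          ((hEsum.const_mul 2).add (hUint.const_mul 2)) (ae_of_all _ hpt)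
    _ = 2 * ∫ q, c * ∑ t ∈ a.powersetCard k, (proxyMSE f est q.1 q.2 t - Y t q.1) ^ 2 ∂μ +
          2 * ∫ S, (U S - L) ^ 2 ∂(acceptedDataLaw env π rej a) := by
        have hfst := integral_fun_fst (μ := acceptedDataLaw env π rej a)
          (ν := Measure.pi fun _ : Fin M => Q) (f := fun S => (U S - L) ^ 2)
        rw [probReal_univ, one_smul] at hfst
        rw [integral_add (hEsum.const_mul 2) (hUint.const_mul 2), integral_const_mul 2,
          integral_const_mul 2, ← hfst]
    _ ≤ _ := by gcongr

/-- The second moment of the proxies, averaged over the subsets. -/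
theorem integral_average_proxyMSE_sq_le (hf : ∀ ϑ p, |f ϑ p| ≤ K)
    (h0 : Measurable (f θ₀)) (hest : ∀ n, Measurable
      fun q : (Fin n → Sample 𝒳 𝒵 𝒜) × (𝒳 × 𝒜) => f (est n q.1) q.2) (hM : 0 < M)
    (a : Finset (Fin n)) :
    ∫ q, (a.card.choose k : ℝ)⁻¹ * ∑ t ∈ a.powersetCard k, proxyMSE f est q.1 q.2 t ^ 2
        ∂((acceptedDataLaw env π rej a).prod (Measure.pi fun _ : Fin M => Q)) ≤
      2 * proxyError env Q π f θ₀ est rej K M a + 2 * lossL2 env Q f θ₀ est π k ^ 2 := by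
  set μ := (acceptedDataLaw env π rej a).prod (Measure.pi fun _ : Fin M => Q) with hμ
  have hnn : 0 ≤ proxyError env Q π f θ₀ est rej K M a := proxyError_nonneg K M a
  rw [integral_const_mul, integral_finsetSum _ fun t _ =>
    (memLp_proxyMSE hf hest t).integrable_sq, ← Finset.card_powersetCard]
  refine average_le (by positivity) fun t ht => ?_
  have hE : Integrable (fun q : (Fin n → Sample 𝒳 𝒵 𝒜) × (Fin M → 𝒳 × 𝒜) =>
      (proxyMSE f est q.1 q.2 t - mse Q f θ₀ (est t.card (subData q.1 t))) ^ 2) μ :=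
    ((memLp_proxyMSE hf hest t).sub (memLp_mse_subData_fst hf h0 hest t)).integrable_sq
  have hY : Integrable (fun q : (Fin n → Sample 𝒳 𝒵 𝒜) × (Fin M → 𝒳 × 𝒜) =>
      mse Q f θ₀ (est t.card (subData q.1 t)) ^ 2) μ :=
    (memLp_mse_subData_fst hf h0 hest t).integrable_sq
  have hY2 : ∫ q, mse Q f θ₀ (est t.card (subData q.1 t)) ^ 2 ∂μ =
      lossL2 env Q f θ₀ est π k ^ 2 := by
    rw [hμ, integral_fun_fst (f := fun S => mse Q f θ₀ (est t.card (subData S t)) ^ 2),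
      integral_mse_subData_sq ht h0 hest]
    simp
  calc ∫ q, proxyMSE f est q.1 q.2 t ^ 2 ∂μ
      ≤ ∫ q, (2 * (proxyMSE f est q.1 q.2 t - mse Q f θ₀ (est t.card (subData q.1 t))) ^ 2 +
          2 * mse Q f θ₀ (est t.card (subData q.1 t)) ^ 2) ∂μ := by
        refine integral_mono_of_nonneg (ae_of_all _ fun _ => sq_nonneg _)
          ((hE.const_mul 2).add (hY.const_mul 2)) (ae_of_all _ fun q => ?_)
        have h := add_sq_le (a := proxyMSE f est q.1 q.2 t -
          mse Q f θ₀ (est t.card (subData q.1 t))) (b := mse Q f θ₀ (est t.card (subData q.1 t)))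
        simp only [sub_add_cancel] at h
        linarith
    _ ≤ _ := by
        rw [integral_add (hE.const_mul 2) (hY.const_mul 2), integral_const_mul,
          integral_const_mul, hY2]
        have := integral_sq_proxyMSE_sub_mse_le (env := env) (π := π) (rej := rej) (θ₀ := θ₀)
          (Q := Q) hf h0 hest hM a t
        linarith

end Accepted

/-! ### The mean square error of the rejection sampling estimate -/

section Estimate

variable {𝒳 𝒰 𝒵 𝒜 Θ : Type*} [MeasurableSpace 𝒳] [MeasurableSpace 𝒰] [MeasurableSpace 𝒵]
  [MeasurableSpace 𝒜] {ν : Measure 𝒵} [SFinite ν] {env : Environment 𝒳 𝒰 𝒵 𝒜}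
  {Q : Measure (𝒳 × 𝒜)} {β π : Policy 𝒳 ν} {f : Θ → 𝒳 × 𝒜 → ℝ} {θ₀ : Θ} {K : ℝ}
  {est : (n : ℕ) → (Fin n → Sample 𝒳 𝒵 𝒜) → Θ}
  {n k M B : ℕ} {Ω : Type*} [MeasurableSpace Ω] {P : Measure Ω}

theorem measurable_drawsAverage (hest : ∀ n, Measurable
      fun q : (Fin n → Sample 𝒳 𝒵 𝒜) × (𝒳 × 𝒜) => f (est n q.1) q.2) :
    Measurable (drawsAverage f est (n := n) (M := M) (B := B)) :=
  measurable_from_prod_countable_left fun t =>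
    (Finset.measurable_sum _ fun b _ => measurable_proxyMSE hest (t b)).const_mul _

/-- The rejection sampling estimate on the event that `a` is the set of accepted indices. -/
noncomputable def RSRun.estimateOn (R : RSRun env Q β π n k M B P) (f : Θ → 𝒳 × 𝒜 → ℝ)
    (est : (n : ℕ) → (Fin n → Sample 𝒳 𝒵 𝒜) → Θ) (v : RSVariant) (a : Finset (Fin n)) (ω : Ω) :
    ℝ :=
  if k ≤ a.card then
    match v with
    | .complete => completeAverage f est k a (R.data ω, R.heldOut ω)
    | .incomplete => drawsAverage f est ((R.data ω, R.heldOut ω), R.draws ω)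
  else 0

theorem RSRun.estimate_eq_estimateOn (R : RSRun env Q β π n k M B P) (v : RSVariant)
    {a : Finset (Fin n)} {ω : Ω} (hω : ω ∈ R.acceptEvent a) :
    R.estimate f est v ω = R.estimateOn f est v a ω := by
  have h : accepted π β (R.data ω) (R.unif ω) = a := hω
  simp only [RSRun.estimate, h]
  cases v <;> rfl

theorem RSRun.measurable_estimateOn (R : RSRun env Q β π n k M B P) (hest : ∀ n, Measurable
      fun q : (Fin n → Sample 𝒳 𝒵 𝒜) × (𝒳 × 𝒜) => f (est n q.1) q.2) (v : RSVariant)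
    (a : Finset (Fin n)) : Measurable (R.estimateOn f est v a) := by
  have hX : Measurable fun ω => (R.data ω, R.heldOut ω) :=
    R.measurable_data.prodMk R.measurable_heldOut
  unfold RSRun.estimateOn
  split_ifs
  · cases v
    · exact (measurable_completeAverage hest a).comp hX
    · exact (measurable_drawsAverage hest).comp (hX.prodMk R.measurable_draws)
  · exact measurable_const

theorem RSRun.abs_estimateOn_le (R : RSRun env Q β π n k M B P) (hf : ∀ ϑ p, |f ϑ p| ≤ K)
    (v : RSVariant) (a : Finset (Fin n)) (ω : Ω) : |R.estimateOn f est v a ω| ≤ 4 * K ^ 2 := by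
  unfold RSRun.estimateOn
  split_ifs
  · cases v
    · exact abs_completeAverage_le hf _ _
    · exact abs_drawsAverage_le hf _
  · rw [abs_zero]; positivity

theorem RSRun.pairwise_disjoint_acceptEvent (R : RSRun env Q β π n k M B P) :
    Pairwise (Function.onFun Disjoint R.acceptEvent) := by
  intro a a' h
  refine Set.disjoint_left.2 fun ω h1 h2 => h ?_
  exact (show accepted π β (R.data ω) (R.unif ω) = a from h1).symm.trans h2

theorem RSRun.iUnion_acceptEvent (R : RSRun env Q β π n k M B P) :
    ⋃ a, R.acceptEvent a = Set.univ :=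
  Set.eq_univ_of_forall fun ω =>
    Set.mem_iUnion.2 ⟨accepted π β (R.data ω) (R.unif ω), rfl⟩

theorem RSRun.measurable_estimate (R : RSRun env Q β π n k M B P) (hest : ∀ n, Measurable
      fun q : (Fin n → Sample 𝒳 𝒵 𝒜) × (𝒳 × 𝒜) => f (est n q.1) q.2) (v : RSVariant) :
    Measurable (R.estimate f est v) := by
  intro s hs
  have h : R.estimate f est v ⁻¹' s =
      ⋃ a, (R.acceptEvent a ∩ R.estimateOn f est v a ⁻¹' s) := by
    ext ω
    simp only [Set.mem_iUnion, Set.mem_inter_iff, Set.mem_preimage]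
    constructor
    · intro h
      exact ⟨accepted π β (R.data ω) (R.unif ω), rfl,
        by rwa [← R.estimate_eq_estimateOn v (ω := ω) rfl]⟩
    · rintro ⟨a, ha, h⟩
      rwa [R.estimate_eq_estimateOn v ha]
  rw [h]
  exact MeasurableSet.iUnion fun a =>
    (R.measurableSet_acceptEvent a).inter (R.measurable_estimateOn hest v a hs)

theorem RSRun.abs_estimate_le (R : RSRun env Q β π n k M B P) (hf : ∀ ϑ p, |f ϑ p| ≤ K)
    (v : RSVariant) (ω : Ω) : |R.estimate f est v ω| ≤ 4 * K ^ 2 := by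
  rw [R.estimate_eq_estimateOn v (ω := ω) rfl]
  exact R.abs_estimateOn_le hf v _ ω

theorem RSRun.memLp_estimate [IsProbabilityMeasure P] (R : RSRun env Q β π n k M B P)
    (hf : ∀ ϑ p, |f ϑ p| ≤ K) (hest : ∀ n, Measurable
      fun q : (Fin n → Sample 𝒳 𝒵 𝒜) × (𝒳 × 𝒜) => f (est n q.1) q.2) (v : RSVariant) :
    MemLp (R.estimate f est v) 2 P :=
  memLp_two_of_bounded (R.measurable_estimate hest v) (R.abs_estimate_le hf v)

/-- The inverse of the number of random subsets in the incomplete variant, and `0` in the complete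
one. -/
noncomputable def RSVariant.invDraws (v : RSVariant) (B : ℕ) : ℝ :=
  match v with
  | .complete => 0
  | .incomplete => (B : ℝ)⁻¹

section GivenAccepted

variable [IsProbabilityMeasure Q] (R : RSRun env Q β π n k M B P)
  (hsupp : ∀ x z, 0 < π.dens x z → 0 < β.dens x z)
  (hρ : BddAbove (Set.range (ratio π β : Sample 𝒳 𝒵 𝒜 → ℝ)))
  {rej : Measure (Sample 𝒳 𝒵 𝒜)} [IsProbabilityMeasure rej]
  (hrej : (((sampleLaw env β).prod unifLaw).restrict (acceptSet π β)ᶜ).map Prod.fst =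
    ENNReal.ofReal (1 - (ratioMax 𝒜 π β)⁻¹) • rej)

include R hsupp hρ hrej

theorem RSRun.integral_map_restrict_acceptEvent (a : Finset (Fin n))
    (G : (Fin n → Sample 𝒳 𝒵 𝒜) × (Fin M → 𝒳 × 𝒜) → ℝ) :
    ∫ q, G q ∂((P.restrict (R.acceptEvent a)).map fun ω => (R.data ω, R.heldOut ω)) =
      acceptWeight (ratioMax 𝒜 π β)⁻¹ n a *
        ∫ q, G q ∂((acceptedDataLaw env π rej a).prod (Measure.pi fun _ : Fin M => Q)) := by
  have h1ρ := one_le_ratioMax env hsupp hρ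
  rw [R.map_restrict_acceptEvent hsupp hρ hrej a, Measure.prod_smul_left, integral_smul_measure,
    ENNReal.toReal_ofReal (acceptWeight_nonneg (inv_nonneg.2 (zero_le_one.trans h1ρ))
      (inv_le_one_of_one_le₀ h1ρ) a), smul_eq_mul]

theorem RSRun.setIntegral_acceptEvent (a : Finset (Fin n))
    {G : (Fin n → Sample 𝒳 𝒵 𝒜) × (Fin M → 𝒳 × 𝒜) → ℝ} (hG : Measurable G) :
    ∫ ω in R.acceptEvent a, G (R.data ω, R.heldOut ω) ∂P =
      acceptWeight (ratioMax 𝒜 π β)⁻¹ n a *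
        ∫ q, G q ∂((acceptedDataLaw env π rej a).prod (Measure.pi fun _ : Fin M => Q)) := by
  have hX : Measurable fun ω => (R.data ω, R.heldOut ω) :=
    R.measurable_data.prodMk R.measurable_heldOut
  rw [← R.integral_map_restrict_acceptEvent hsupp hρ hrej a G,
    integral_map hX.aemeasurable hG.aestronglyMeasurable]

/-- Given the set of accepted indices, the full dataset no longer consists of samples from `β`, but
averaging over this set recovers the expected error of `θ(D_n)` under `β`. -/
theorem RSRun.sum_acceptWeight_mul_integral [IsProbabilityMeasure P]
    (h0 : Measurable (f θ₀)) (hf : ∀ ϑ p, |f ϑ p| ≤ K)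
    (hest : ∀ n, Measurable
      fun q : (Fin n → Sample 𝒳 𝒵 𝒜) × (𝒳 × 𝒜) => f (est n q.1) q.2) :
    ∑ a, acceptWeight (ratioMax 𝒜 π β)⁻¹ n a *
        ∫ S, mse Q f θ₀ (est n S) ∂(acceptedDataLaw env π rej a) =
      loss env Q f θ₀ est β n := by
  have hm := measurable_mse_est (Q := Q) h0 hest n
  have hint : Integrable (fun ω => mse Q f θ₀ (est n (R.data ω))) P :=
    integrable_of_bounded (hm.comp R.measurable_data) (c := 4 * K ^ 2) fun ω => by
      rw [abs_of_nonneg (mse_nonneg _)]; exact mse_le hf _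
  rw [loss, ← R.map_data, integral_map R.measurable_data.aemeasurable hm.aestronglyMeasurable,
    ← setIntegral_univ, ← R.iUnion_acceptEvent, integral_iUnion_fintype
      R.measurableSet_acceptEvent R.pairwise_disjoint_acceptEvent fun a => hint.integrableOn]
  refine Finset.sum_congr rfl fun a _ => ?_
  have h := R.setIntegral_acceptEvent hsupp hρ hrej a
    (G := fun q => mse Q f θ₀ (est n q.1)) (hm.comp measurable_fst)
  rw [h, integral_fun_fst (f := fun S => mse Q f θ₀ (est n S))]
  simp

/-- The contribution of the event that `a` is the accepted set, when too few samples are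
accepted. -/
theorem RSRun.setIntegral_sq_of_card_lt (hf : ∀ ϑ p, |f ϑ p| ≤ K) (h0 : Measurable (f θ₀))
    (hest : ∀ n, Measurable
      fun q : (Fin n → Sample 𝒳 𝒵 𝒜) × (𝒳 × 𝒜) => f (est n q.1) q.2) (v : RSVariant)
    {a : Finset (Fin n)} (ha : a.card < k) :
    ∫ ω in R.acceptEvent a, (R.estimate f est v ω - loss env Q f θ₀ est π k) ^ 2 ∂P ≤
      acceptWeight (ratioMax 𝒜 π β)⁻¹ n a * lossL2 env Q f θ₀ est π k ^ 2 := by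
  have h1ρ := one_le_ratioMax env hsupp hρ
  have hw := acceptWeight_nonneg (inv_nonneg.2 (zero_le_one.trans h1ρ))
      (inv_le_one_of_one_le₀ h1ρ) a
  have hc : ∀ ω ∈ R.acceptEvent a, (R.estimate f est v ω - loss env Q f θ₀ est π k) ^ 2 =
      loss env Q f θ₀ est π k ^ 2 := by
    intro ω hω
    rw [R.estimate_eq_estimateOn v hω]
    unfold RSRun.estimateOn
    rw [if_neg (not_le.2 ha)]
    ring
  rw [setIntegral_congr_fun (R.measurableSet_acceptEvent a) hc,
    R.setIntegral_acceptEvent hsupp hρ hrej a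
      (G := fun _ => loss env Q f θ₀ est π k ^ 2) measurable_const]
  refine mul_le_mul_of_nonneg_left ?_ hw
  simpa using loss_sq_le hf h0 hest k

/-- The contribution of the event that `a` is the accepted set, when enough samples are accepted.
Drawing the subsets at random adds to the error of the complete estimate a `B`-th of the second
moment of the proxies. -/
theorem RSRun.setIntegral_sq_of_le_card [IsProbabilityMeasure P]
    (hf : ∀ ϑ p, |f ϑ p| ≤ K) (h0 : Measurable (f θ₀))
    (hest : ∀ n, Measurable
      fun q : (Fin n → Sample 𝒳 𝒵 𝒜) × (𝒳 × 𝒜) => f (est n q.1) q.2) (v : RSVariant)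
    (hk : 0 < k) (hM : 0 < M) (hB : v = .incomplete → 0 < B)
    {a : Finset (Fin n)} (ha : k ≤ a.card) :
    ∫ ω in R.acceptEvent a, (R.estimate f est v ω - loss env Q f θ₀ est π k) ^ 2 ∂P ≤
      acceptWeight (ratioMax 𝒜 π β)⁻¹ n a *
        (4 * proxyError env Q π f θ₀ est rej K M a +
          2 * (lossL2 env Q f θ₀ est π k ^ 2 / (a.card / k : ℕ)) +
          2 * lossL2 env Q f θ₀ est π k ^ 2 * v.invDraws B) := by
  have h1ρ := one_le_ratioMax env hsupp hρ
  have hw := acceptWeight_nonneg (inv_nonneg.2 (zero_le_one.trans h1ρ))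
      (inv_le_one_of_one_le₀ h1ρ) a
  have hnn : 0 ≤ proxyError env Q π f θ₀ est rej K M a := proxyError_nonneg K M a
  set L := loss env Q f θ₀ est π k
  have hX : Measurable fun ω => (R.data ω, R.heldOut ω) :=
    R.measurable_data.prodMk R.measurable_heldOut
  have hcomp := integral_sq_completeAverage_sub_loss_le (env := env) (π := π) (rej := rej)
    (Q := Q) (θ₀ := θ₀) hf h0 hest hM hk ha
  have hCm : Measurable fun q : (Fin n → Sample 𝒳 𝒵 𝒜) × (Fin M → 𝒳 × 𝒜) =>
      (completeAverage f est k a q - L) ^ 2 :=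
    ((measurable_completeAverage hest a).sub_const _).pow_const 2
  rw [setIntegral_congr_fun (g := fun ω => (R.estimateOn f est v a ω - L) ^ 2)
    (R.measurableSet_acceptEvent a) fun ω hω => by
      simp only [R.estimate_eq_estimateOn v hω]]
  unfold RSRun.estimateOn
  simp only [if_pos ha]
  cases v with
  | complete =>
    simp only
    rw [R.setIntegral_acceptEvent hsupp hρ hrej a hCm]
    refine mul_le_mul_of_nonneg_left ?_ hw
    simp only [RSVariant.invDraws, mul_zero, add_zero]
    linarith
  | incomplete =>
    have hB0 : 0 < B := hB rfl
    have : Nonempty (Fin B) := ⟨⟨0, hB0⟩⟩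
    have := isProbabilityMeasure_uniformSubset ha
    have hB1 : ((B : ℝ))⁻¹ ≤ 1 := inv_le_one_of_one_le₀ (by exact_mod_cast hB0)
    set η := (P.restrict (R.acceptEvent a)).map (fun ω => (R.data ω, R.heldOut ω)) with hη
    have hηfin : IsFiniteMeasure η := Measure.isFiniteMeasure_map _ _
    have hDm : Measurable fun q : ((Fin n → Sample 𝒳 𝒵 𝒜) × (Fin M → 𝒳 × 𝒜)) ×
        (Fin B → Finset (Fin n)) => (drawsAverage f est q - L) ^ 2 :=
      ((measurable_drawsAverage hest).sub_const _).pow_const 2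
    have hDint : Integrable (fun q : ((Fin n → Sample 𝒳 𝒵 𝒜) × (Fin M → 𝒳 × 𝒜)) ×
        (Fin B → Finset (Fin n)) => (drawsAverage f est q - L) ^ 2)
        (η.prod (Measure.pi fun _ : Fin B => uniformSubset k a)) :=
      ((memLp_two_of_bounded (measurable_drawsAverage hest)
        (abs_drawsAverage_le hf)).sub (memLp_const L)).integrable_sq
    have hCint : Integrable (fun q => (completeAverage f est k a q - L) ^ 2) η :=
      ((memLp_two_of_bounded (measurable_completeAverage hest a)
        (abs_completeAverage_le hf a)).sub (memLp_const L)).integrable_sq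
    have hSint : Integrable (fun q : (Fin n → Sample 𝒳 𝒵 𝒜) × (Fin M → 𝒳 × 𝒜) =>
        (a.card.choose k : ℝ)⁻¹ * ∑ t ∈ a.powersetCard k, proxyMSE f est q.1 q.2 t ^ 2) η :=
      (integrable_finsetSum _ fun t _ => (memLp_proxyMSE hf hest t).integrable_sq).const_mul _
    have hinner : ∀ q : (Fin n → Sample 𝒳 𝒵 𝒜) × (Fin M → 𝒳 × 𝒜),
        ∫ t, (drawsAverage f est (q, t) - L) ^ 2
            ∂(Measure.pi fun _ : Fin B => uniformSubset k a) ≤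
          (completeAverage f est k a q - L) ^ 2 +
            (B : ℝ)⁻¹ * ((a.card.choose k : ℝ)⁻¹ *
              ∑ t ∈ a.powersetCard k, proxyMSE f est q.1 q.2 t ^ 2) := by
      intro q
      have h := integral_sq_iid_average_sub_le (κ := Fin B) (μ := uniformSubset k a)
        (g := fun t => proxyMSE f est q.1 q.2 t)
        (memLp_two_of_bounded (Measurable.of_discrete) fun t => abs_proxyMSE_le hf _ _ t) L
      rw [integral_uniformSubset, integral_uniformSubset, Fintype.card_fin,
        div_eq_inv_mul] at h
      exact h
    have hsec := integral_average_proxyMSE_sq_le (env := env) (π := π) (rej := rej) (k := k)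
      (Q := Q) (θ₀ := θ₀) hf h0 hest hM a
    have hpush : ∫ ω in R.acceptEvent a,
        (drawsAverage f est ((R.data ω, R.heldOut ω), R.draws ω) - L) ^ 2 ∂P =
        ∫ q, (drawsAverage f est q - L) ^ 2
          ∂(η.prod (Measure.pi fun _ : Fin B => uniformSubset k a)) := by
      rw [hη, ← R.map_restrict_acceptEvent_draws ha,
        integral_map (hX.prodMk R.measurable_draws).aemeasurable hDm.aestronglyMeasurable]
    simp only
    rw [hpush, integral_prod _ hDint]
    calc _ ≤ ∫ q, ((completeAverage f est k a q - L) ^ 2 +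
            (B : ℝ)⁻¹ * ((a.card.choose k : ℝ)⁻¹ *
              ∑ t ∈ a.powersetCard k, proxyMSE f est q.1 q.2 t ^ 2)) ∂η :=
          integral_mono hDint.integral_prod_left (hCint.add (hSint.const_mul _)) hinner
      _ = acceptWeight (ratioMax 𝒜 π β)⁻¹ n a *
            (∫ q, (completeAverage f est k a q - L) ^ 2
              ∂((acceptedDataLaw env π rej a).prod (Measure.pi fun _ : Fin M => Q)) +
            (B : ℝ)⁻¹ * ∫ q, (a.card.choose k : ℝ)⁻¹ *
              ∑ t ∈ a.powersetCard k, proxyMSE f est q.1 q.2 t ^ 2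
              ∂((acceptedDataLaw env π rej a).prod (Measure.pi fun _ : Fin M => Q))) := by
          rw [integral_add hCint (hSint.const_mul _), integral_const_mul (B : ℝ)⁻¹, hη,
            R.integral_map_restrict_acceptEvent hsupp hρ hrej,
            R.integral_map_restrict_acceptEvent hsupp hρ hrej]
          ring
      _ ≤ _ := by
          refine mul_le_mul_of_nonneg_left ?_ hw
          have h1 : (B : ℝ)⁻¹ * (2 * proxyError env Q π f θ₀ est rej K M a) ≤
              2 * proxyError env Q π f θ₀ est rej K M a :=
            mul_le_of_le_one_left (by linarith) hB1
          have h2 := mul_le_mul_of_nonneg_left hsec (inv_nonneg.2 (Nat.cast_nonneg (α := ℝ) B))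
          simp only [RSVariant.invDraws]
          linarith

end GivenAccepted

/-- The finite-sample bound: the lower tail of the number of accepted samples, the variance of the
U-statistic, the random choice of the subsets, the plug-in of `θ(D_n)` for the true parameter, and
the held-out average. -/
theorem RSRun.integral_sq_estimate_sub_loss_le [IsProbabilityMeasure Q] [IsProbabilityMeasure P]
    (R : RSRun env Q β π n k M B P)
    (hsupp : ∀ x z, 0 < π.dens x z → 0 < β.dens x z)
    (hρ : BddAbove (Set.range (ratio π β : Sample 𝒳 𝒵 𝒜 → ℝ)))
    (hf : ∀ ϑ p, |f ϑ p| ≤ K) (h0 : Measurable (f θ₀)) (hest : ∀ n, Measurable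
      fun q : (Fin n → Sample 𝒳 𝒵 𝒜) × (𝒳 × 𝒜) => f (est n q.1) q.2) (v : RSVariant)
    (hk : 0 < k) (hM : 0 < M) (hB : v = .incomplete → 0 < B)
    (hkn : (k : ℝ) ≤ n * (ratioMax 𝒜 π β)⁻¹ / 2) :
    ∫ ω, (R.estimate f est v ω - loss env Q f θ₀ est π k) ^ 2 ∂P ≤
      lossL2 env Q f θ₀ est π k ^ 2 *
        (2 * Real.exp (-(n : ℝ) / (8 * ratioMax 𝒜 π β)) + 8 * ratioMax 𝒜 π β * (k / n) +
          2 * v.invDraws B) +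
      64 * K ^ 2 * loss env Q f θ₀ est β n + 64 * K ^ 4 / M := by
  obtain ⟨rej, hrejp, hrej⟩ := exists_map_restrict_acceptSet_compl env hsupp hρ
  have h1ρ := one_le_ratioMax env hsupp hρ
  set ρ := ratioMax 𝒜 π β
  have hρ0 : 0 < ρ := one_pos.trans_le h1ρ
  set p := ρ⁻¹ with hp
  have hp0 : 0 ≤ p := inv_nonneg.2 hρ0.le
  have hp1 : p ≤ 1 := inv_le_one_of_one_le₀ h1ρ
  have hk0 : (0 : ℝ) < k := by exact_mod_cast hk
  have hn0 : (0 : ℝ) < n := by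
    rcases Nat.eq_zero_or_pos n with h | h
    · rw [h] at hkn; simp at hkn; omega
    · exact_mod_cast h
  set α2 := lossL2 env Q f θ₀ est π k ^ 2
  have hα0 : 0 ≤ α2 := sq_nonneg _
  set L := loss env Q f θ₀ est π k
  set e : Finset (Fin n) → ℝ := proxyError env Q π f θ₀ est rej K M with he
  have he0 : ∀ a, 0 ≤ e a := proxyError_nonneg K M
  have hw0 : ∀ a, 0 ≤ acceptWeight p n a := acceptWeight_nonneg hp0 hp1
  have hb0 : 0 ≤ v.invDraws B := by
    cases v
    · exact le_rfl
    · exact inv_nonneg.2 (Nat.cast_nonneg _)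
  have hint : Integrable (fun ω => (R.estimate f est v ω - L) ^ 2) P :=
    ((R.memLp_estimate hf hest v).sub (memLp_const L)).integrable_sq
  -- the accepted sets of atypically small size
  let small : Finset (Finset (Fin n)) := Finset.univ.filter fun a => (a.card : ℝ) < n * p / 2
  have hev : ∀ a, ∫ ω in R.acceptEvent a, (R.estimate f est v ω - L) ^ 2 ∂P ≤
      acceptWeight p n a * (4 * e a) + acceptWeight p n a * (2 * α2 * v.invDraws B) +
        acceptWeight p n a * (8 * ρ * (k / n) * α2) +
        (if a ∈ small then acceptWeight p n a * (2 * α2) else 0) := by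
    intro a
    have hrate : 0 ≤ 8 * ρ * (k / n) * α2 := by positivity
    rcases lt_or_ge a.card k with ha | ha
    · have hmem : a ∈ small := by
        refine Finset.mem_filter.2 ⟨Finset.mem_univ _, lt_of_lt_of_le ?_ hkn⟩
        exact_mod_cast ha
      rw [if_pos hmem]
      refine (R.setIntegral_sq_of_card_lt hsupp hρ hrej hf h0 hest v ha).trans ?_
      rw [← mul_add, ← mul_add, ← mul_add]
      refine mul_le_mul_of_nonneg_left ?_ (hw0 a)
      have := he0 a
      have : 0 ≤ 2 * α2 * v.invDraws B := by positivity
      linarith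
    · refine (R.setIntegral_sq_of_le_card hsupp hρ hrej hf h0 hest v hk hM hB ha).trans ?_
      have hq1 : 1 ≤ a.card / k := (Nat.one_le_div_iff hk).2 ha
      have hq1' : (1 : ℝ) ≤ (a.card / k : ℕ) := by exact_mod_cast hq1
      by_cases hmem : a ∈ small
      · rw [if_pos hmem, ← mul_add, ← mul_add, ← mul_add]
        refine mul_le_mul_of_nonneg_left ?_ (hw0 a)
        have : α2 / (a.card / k : ℕ) ≤ α2 := div_le_self hα0 hq1'
        linarith
      · rw [if_neg hmem, add_zero, ← mul_add, ← mul_add]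
        refine mul_le_mul_of_nonneg_left ?_ (hw0 a)
        have hbig : n * p / 2 ≤ a.card := by
          by_contra hlt
          exact hmem (Finset.mem_filter.2 ⟨Finset.mem_univ _, not_le.1 hlt⟩)
        -- `⌊m / k⌋ ≥ m / (2 k)` once `m ≥ k`
        have hfloor : (a.card : ℝ) ≤ 2 * k * (a.card / k : ℕ) := by
          have h1 : a.card < k * (a.card / k) + k := by
            have := Nat.div_add_mod a.card k
            have := Nat.mod_lt a.card hk
            omega
          have h2 : k ≤ k * (a.card / k) := Nat.le_mul_of_pos_right _ hq1
          have h3 : a.card ≤ 2 * k * (a.card / k) := by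
            rw [mul_assoc]; omega
          exact_mod_cast h3
        have hq : α2 / (a.card / k : ℕ) ≤ 4 * ρ * (k / n) * α2 := by
          rw [div_le_iff₀ (by linarith)]
          have h4 : (1 : ℝ) ≤ 4 * ρ * (k / n) * (a.card / k : ℕ) := by
            have h5 : (n : ℝ) * p / 2 ≤ 2 * k * (a.card / k : ℕ) := hbig.trans hfloor
            have h6 : (n : ℝ) ≤ 4 * ρ * k * (a.card / k : ℕ) := by
              have h7 := mul_le_mul_of_nonneg_left h5 (by positivity : 0 ≤ 2 * ρ)
              have h8 : 2 * ρ * (n * p / 2) = n := by rw [hp]; field_simp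
              rw [h8] at h7
              linarith
            calc (1 : ℝ) = n / n := (div_self hn0.ne').symm
              _ ≤ 4 * ρ * k * (a.card / k : ℕ) / n := by gcongr
              _ = _ := by ring
          nlinarith
        linarith
  have hsmall : ∑ a ∈ small, acceptWeight p n a ≤ Real.exp (-(n : ℝ) / (8 * ρ)) := by
    have h := sum_bernoulli_lower_tail_le (α := Fin n) hp0 hp1
    rw [Fintype.card_fin] at h
    refine h.trans (le_of_eq ?_)
    rw [hp]
    congr 1
    field_simp
  have hsumw := sum_acceptWeight p n
  have hsume : ∑ a, acceptWeight p n a * (4 * e a) =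
      64 * K ^ 2 * loss env Q f θ₀ est β n + 64 * K ^ 4 / M := by
    rw [← R.sum_acceptWeight_mul_integral hsupp hρ hrej h0 hf hest, Finset.mul_sum]
    have h64 : 64 * K ^ 4 / (M : ℝ) = ∑ a, acceptWeight p n a * (64 * K ^ 4 / M) := by
      rw [← Finset.sum_mul, hsumw, one_mul]
    rw [h64, ← Finset.sum_add_distrib]
    refine Finset.sum_congr rfl fun a _ => ?_
    rw [he, proxyError]
    ring
  rw [← setIntegral_univ, ← R.iUnion_acceptEvent, integral_iUnion_fintype
      R.measurableSet_acceptEvent R.pairwise_disjoint_acceptEvent fun a => hint.integrableOn]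
  refine (Finset.sum_le_sum fun a _ => hev a).trans ?_
  rw [Finset.sum_add_distrib, Finset.sum_add_distrib, Finset.sum_add_distrib, hsume,
    ← Finset.sum_mul, ← Finset.sum_mul, hsumw, Finset.sum_ite_mem, Finset.univ_inter,
    ← Finset.sum_mul]
  have := mul_le_mul_of_nonneg_right hsmall (by positivity : 0 ≤ 2 * α2)
  linarith

end Estimate

/-! ### Rates -/

section Rates

theorem errorRate_pos {r ε : ℕ → ℝ} {k : ℕ → ℕ} {ρ : ℝ} {n : ℕ} (hn : 0 < r n) :
    0 < errorRate r ε k ρ n := by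
  have := Real.exp_pos (-(n : ℝ) / (8 * ρ))
  unfold errorRate
  positivity

theorem tendsto_errorRate {r ε : ℕ → ℝ} {k : ℕ → ℕ} {ρ : ℝ} (hρ : 0 < ρ)
    (hε : Tendsto ε atTop (𝓝 0)) (hk : Tendsto k atTop atTop)
    (hkn : Tendsto (fun n => (k n : ℝ) / n) atTop (𝓝 0))
    (hrk : Tendsto (fun n => r (k n) ^ 2 / r n) atTop (𝓝 0)) :
    Tendsto (errorRate r ε k ρ) atTop (𝓝 0) := by
  have h1 : Tendsto (fun n => ε (k n) ^ 2) atTop (𝓝 0) := by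
    simpa using (hε.comp hk).pow 2
  have h2 : Tendsto (fun n : ℕ => Real.exp (-(n : ℝ) / (8 * ρ))) atTop (𝓝 0) := by
    refine Real.tendsto_exp_neg_atTop_nhds_zero.comp
      (tendsto_natCast_atTop_atTop.atTop_div_const (by positivity : 0 < 8 * ρ)) |>.congr fun n => ?_
    simp [neg_div]
  have h := ((h1.add hkn).add hrk).add h2
  simp only [add_zero] at h
  exact h

variable {𝒳 𝒰 𝒵 𝒜 Θ : Type*} [MeasurableSpace 𝒳] [MeasurableSpace 𝒰] [MeasurableSpace 𝒵]
  [MeasurableSpace 𝒜] {ν : Measure 𝒵} [SFinite ν] {env : Environment 𝒳 𝒰 𝒵 𝒜}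
  {Q : Measure (𝒳 × 𝒜)} [IsProbabilityMeasure Q] {β π : Policy 𝒳 ν} {f : Θ → 𝒳 × 𝒜 → ℝ}
  {θ₀ : Θ} {K : ℝ} {est : (n : ℕ) → (Fin n → Sample 𝒳 𝒵 𝒜) → Θ}
  {r ε : ℕ → ℝ} {v : RSVariant} {k M B : ℕ → ℕ} {Ω : ℕ → Type*} [∀ n, MeasurableSpace (Ω n)]
  {P : ∀ n, Measure (Ω n)} [∀ n, IsProbabilityMeasure (P n)]

/-- The scaled mean square error of the rejection sampling estimate is of the order of
`errorRate`. -/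
theorem exists_eventually_le_errorRate
    (hf : ∀ ϑ p, |f ϑ p| ≤ K) (h0 : Measurable (f θ₀)) (hest : ∀ n, Measurable
      fun q : (Fin n → Sample 𝒳 𝒵 𝒜) × (𝒳 × 𝒜) => f (est n q.1) q.2)
    (hsupp : ∀ x z, 0 < π.dens x z → 0 < β.dens x z)
    (hρ : BddAbove (Set.range (ratio π β : Sample 𝒳 𝒵 𝒜 → ℝ)))
    (hr : ∀ n, 1 ≤ n → 0 < r n)
    (hα : (fun n => r n * lossL2 env Q f θ₀ est π n) =O[atTop] (fun _ => (1 : ℝ)))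
    (hαβ : (fun n => r n * lossL2 env Q f θ₀ est β n) =O[atTop] (fun _ => (1 : ℝ)))
    (hk : Tendsto k atTop atTop)
    (hkn : Tendsto (fun n => (k n : ℝ) / n) atTop (𝓝 0))
    (hM : (fun n : ℕ => (n : ℝ) * r (k n) ^ 2 / k n) =O[atTop] (fun n : ℕ => (M n : ℝ)))
    (hB : v = .incomplete → (fun n : ℕ => (n : ℝ) / k n) =O[atTop] (fun n : ℕ => (B n : ℝ)))
    (R : ∀ n, RSRun env Q β π n (k n) (M n) (B n) (P n)) :
    ∃ C : ℝ, 0 < C ∧ ∀ᶠ n in atTop,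
      2 * ε (k n) ^ 2 + 2 * r (k n) ^ 2 *
          ∫ ω, ((R n).estimate f est v ω - loss env Q f θ₀ est π (k n)) ^ 2 ∂(P n) ≤
        C * errorRate r ε k (ratioMax 𝒜 π β) n := by
  have hρ1 := one_le_ratioMax env hsupp hρ
  set ρ := ratioMax 𝒜 π β with hρdef
  have hρ0 : 0 < ρ := one_pos.trans_le hρ1
  obtain ⟨A, hA0, hA⟩ := (hα.comp_tendsto hk).exists_pos
  obtain ⟨A', hA'0, hA'⟩ := hαβ.exists_pos
  obtain ⟨cM, hcM0, hcM⟩ := hM.exists_pos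
  have hkpos : ∀ᶠ n in atTop, 1 ≤ k n := hk.eventually_ge_atTop 1
  have hB' : ∃ cB : ℝ, 0 < cB ∧ ∀ᶠ n in atTop,
      (v = .incomplete → 0 < B n) ∧ v.invDraws (B n) ≤ cB * (k n / n) := by
    cases v with
    | complete =>
      refine ⟨1, one_pos, Eventually.of_forall fun n => ⟨by simp, ?_⟩⟩
      simp only [RSVariant.invDraws]
      positivity
    | incomplete =>
      obtain ⟨cB, hcB0, hcB⟩ := (hB rfl).exists_pos
      refine ⟨cB, hcB0, ?_⟩
      filter_upwards [hcB.bound, hkpos, eventually_ge_atTop 1] with n h1 h2 h3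
      have hk0 : (0 : ℝ) < k n := by exact_mod_cast h2
      have hn0 : (0 : ℝ) < n := by exact_mod_cast h3
      rw [Real.norm_of_nonneg (by positivity), Real.norm_of_nonneg (by positivity)] at h1
      have hBpos : (0 : ℝ) < B n := by
        have := (div_pos hn0 hk0).trans_le h1
        exact pos_of_mul_pos_right this hcB0.le
      refine ⟨fun _ => by exact_mod_cast hBpos, ?_⟩
      simp only [RSVariant.invDraws]
      rw [inv_le_iff_one_le_mul₀ hBpos]
      calc (1 : ℝ) = (k n / n) * (n / k n) := by field_simp
        _ ≤ (k n / n) * (cB * B n) := by gcongr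
        _ = cB * (k n / n) * B n := by ring
  obtain ⟨cB, hcB0, hcB⟩ := hB'
  refine ⟨2 + 4 * A ^ 2 + 2 * A ^ 2 * (8 * ρ + 2 * cB) + 128 * K ^ 4 * cM + 128 * K ^ 2 * A',
    by positivity, ?_⟩
  have hkn' : ∀ᶠ n in atTop, (k n : ℝ) / n < ρ⁻¹ / 2 :=
    hkn.eventually_lt_const (by positivity)
  filter_upwards [hA.bound, hA'.bound, hcM.bound, hkpos, hcB, hkn', eventually_ge_atTop 1] with
    n h1 h2 h3 h4 h5 h6 h7
  have hk0 : (0 : ℝ) < k n := by exact_mod_cast h4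
  have hn0 : (0 : ℝ) < n := by exact_mod_cast h7
  have hrn := hr n h7
  have hrk := hr (k n) h4
  simp only [Function.comp] at h1
  rw [norm_one, mul_one] at h1 h2
  rw [Real.norm_of_nonneg (mul_nonneg hrk.le (lossL2_nonneg _))] at h1
  rw [Real.norm_of_nonneg (mul_nonneg hrn.le (lossL2_nonneg _))] at h2
  rw [Real.norm_of_nonneg (by positivity), Real.norm_of_nonneg (by positivity)] at h3
  have hMpos : (0 : ℝ) < M n :=
    pos_of_mul_pos_right ((by positivity : 0 < (n : ℝ) * r (k n) ^ 2 / k n).trans_le h3) hcM0.le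
  have hbound := (R n).integral_sq_estimate_sub_loss_le hsupp hρ hf h0 hest v h4
    (by exact_mod_cast hMpos) h5.1 (by
      rw [div_lt_iff₀ hn0] at h6
      rw [← hρdef]
      linarith)
  rw [← hρdef] at hbound
  -- the terms of the finite-sample bound, after multiplication by `r_k ^ 2`
  have hα2 : r (k n) ^ 2 * lossL2 env Q f θ₀ est π (k n) ^ 2 ≤ A ^ 2 := by
    rw [← mul_pow]
    exact pow_le_pow_left₀ (mul_nonneg hrk.le (lossL2_nonneg _)) h1 2
  have hβ : r (k n) ^ 2 * loss env Q f θ₀ est β n ≤ A' * (r (k n) ^ 2 / r n) := by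
    have h8 : loss env Q f θ₀ est β n ≤ A' / r n := by
      rw [le_div_iff₀ hrn, mul_comm]
      exact (mul_le_mul_of_nonneg_left (loss_le_lossL2 hf h0 hest n) hrn.le).trans h2
    calc r (k n) ^ 2 * loss env Q f θ₀ est β n ≤ r (k n) ^ 2 * (A' / r n) := by gcongr
      _ = _ := by ring
  have hMr : r (k n) ^ 2 / M n ≤ cM * (k n / n) := by
    rw [div_le_iff₀ hMpos]
    calc r (k n) ^ 2 = (k n / n) * (n * r (k n) ^ 2 / k n) := by field_simp
      _ ≤ (k n / n) * (cM * M n) := by gcongr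
      _ = _ := by ring
  set e := Real.exp (-(n : ℝ) / (8 * ρ))
  set κ := (k n : ℝ) / n
  set s := r (k n) ^ 2 / r n
  have he0 : 0 ≤ e := Real.exp_nonneg _
  have hκ0 : 0 ≤ κ := by positivity
  have hs0 : 0 ≤ s := by positivity
  have hsq : 0 ≤ ε (k n) ^ 2 := sq_nonneg _
  have hb0 : 0 ≤ v.invDraws (B n) := by
    cases v
    · exact le_rfl
    · exact inv_nonneg.2 (Nat.cast_nonneg _)
  have hI : r (k n) ^ 2 *
      ∫ ω, ((R n).estimate f est v ω - loss env Q f θ₀ est π (k n)) ^ 2 ∂(P n) ≤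
        A ^ 2 * (2 * e + 8 * ρ * κ + 2 * (cB * κ)) + 64 * K ^ 2 * (A' * s) +
          64 * K ^ 4 * (cM * κ) := by
    calc _ ≤ r (k n) ^ 2 * (lossL2 env Q f θ₀ est π (k n) ^ 2 *
          (2 * e + 8 * ρ * κ + 2 * v.invDraws (B n)) +
            64 * K ^ 2 * loss env Q f θ₀ est β n + 64 * K ^ 4 / M n) := by gcongr
      _ = r (k n) ^ 2 * lossL2 env Q f θ₀ est π (k n) ^ 2 *
          (2 * e + 8 * ρ * κ + 2 * v.invDraws (B n)) +
            64 * K ^ 2 * (r (k n) ^ 2 * loss env Q f θ₀ est β n) +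
            64 * K ^ 4 * (r (k n) ^ 2 / M n) := by ring
      _ ≤ _ := by
          have := h5.2
          gcongr
  have hrate : errorRate r ε k ρ n = ε (k n) ^ 2 + κ + s + e := rfl
  rw [hrate]
  have hcoef : ∀ {c x : ℝ}, 0 ≤ c → 0 ≤ x → x ≤ ε (k n) ^ 2 + κ + s + e →
      c * x ≤ c * (ε (k n) ^ 2 + κ + s + e) := fun hc _ hx => mul_le_mul_of_nonneg_left hx hc
  have t1 := hcoef (c := 2) (by norm_num) hsq (by linarith)
  have t2 := hcoef (c := 4 * A ^ 2) (by positivity) he0 (by linarith)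
  have t3 := hcoef (c := 2 * A ^ 2 * (8 * ρ + 2 * cB)) (by positivity) hκ0 (by linarith)
  have t4 := hcoef (c := 128 * K ^ 4 * cM) (by positivity) hκ0 (by linarith)
  have t5 := hcoef (c := 128 * K ^ 2 * A') (by positivity) hs0 (by linarith)
  linarith

/-- Chebyshev's inequality at level `δ / 2`. -/
theorem measureReal_two_div_mul_sqrt_lt_abs_le {Ω : Type*} [MeasurableSpace Ω] {P : Measure Ω}
    [IsProbabilityMeasure P] {X : Ω → ℝ} (hX : MemLp X 2 P) {γ δ : ℝ} (hγ : 0 < γ)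
    (h : ∫ ω, X ω ^ 2 ∂P ≤ γ) (hδ0 : 0 < δ) (hδ1 : δ < 1) :
    P.real {ω | 2 / δ * √γ < |X ω|} ≤ δ / 2 := by
  have hc : 0 < 2 / δ * √γ := by positivity
  have hm := mul_meas_ge_le_integral_of_nonneg (μ := P) (f := fun ω => X ω ^ 2)
    (ae_of_all _ fun _ => sq_nonneg _) hX.integrable_sq ((2 / δ * √γ) ^ 2)
  have hsub : P.real {ω | 2 / δ * √γ < |X ω|} ≤ P.real {ω | (2 / δ * √γ) ^ 2 ≤ X ω ^ 2} := by
    refine measureReal_mono fun ω (hω : 2 / δ * √γ < |X ω|) => ?_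
    show (2 / δ * √γ) ^ 2 ≤ X ω ^ 2
    rw [← sq_abs (X ω)]
    exact pow_le_pow_left₀ hc.le hω.le 2
  have hsq : (2 / δ * √γ) ^ 2 = 4 / δ ^ 2 * γ := by
    rw [mul_pow, Real.sq_sqrt hγ.le]; ring
  have h1 : 4 / δ ^ 2 * γ * P.real {ω | 2 / δ * √γ < |X ω|} ≤ γ := by
    rw [← hsq]
    exact (mul_le_mul_of_nonneg_left hsub (sq_nonneg _)).trans (hm.trans h)
  have h2 : P.real {ω | 2 / δ * √γ < |X ω|} ≤ δ ^ 2 / 4 := by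
    have h3 : 4 / δ ^ 2 * γ * P.real {ω | 2 / δ * √γ < |X ω|} =
        γ * (P.real {ω | 2 / δ * √γ < |X ω|} / (δ ^ 2 / 4)) := by field_simp
    rw [h3] at h1
    have h4 := le_of_mul_le_mul_left (h1.trans_eq (mul_one γ).symm) hγ
    rwa [div_le_one (by positivity)] at h4
  nlinarith

end Rates

end IVPolicy

theorem mainTheorem7
    {𝒳 𝒰 𝒵 𝒜 Θ ι : Type*} [MeasurableSpace 𝒳] [MeasurableSpace 𝒰] [MeasurableSpace 𝒵]
    [MeasurableSpace 𝒜] {ν : Measure 𝒵} [SFinite ν]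
    (env : IVPolicy.Environment 𝒳 𝒰 𝒵 𝒜)
    (Q : Measure (𝒳 × 𝒜)) [IsProbabilityMeasure Q]
    -- the prediction model, with uniformly bounded predictions, and the true parameter
    (f : Θ → 𝒳 × 𝒜 → ℝ) (θ₀ : Θ)
    (hf_bdd : ∃ K : ℝ, ∀ ϑ p, |f ϑ p| ≤ K)
    (hf_meas : Measurable (f θ₀))
    -- the estimator, symmetric in the samples
    (est : (n : ℕ) → (Fin n → IVPolicy.Sample 𝒳 𝒵 𝒜) → Θ)
    (hest_meas : ∀ n, Measurable
      fun q : (Fin n → IVPolicy.Sample 𝒳 𝒵 𝒜) × (𝒳 × 𝒜) => f (est n q.1) q.2)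
    (hest_symm : ∀ (n : ℕ) (σ : Equiv.Perm (Fin n)) (D : Fin n → IVPolicy.Sample 𝒳 𝒵 𝒜),
      est n (D ∘ σ) = est n D)
    -- the logging policy and the candidate policies, with bounded importance ratios
    (β : IVPolicy.Policy 𝒳 ν) (π : ι → IVPolicy.Policy 𝒳 ν)
    (hsupp : ∀ i x z, 0 < (π i).dens x z → 0 < β.dens x z)
    (hρ : ∀ i, BddAbove (Set.range
      (IVPolicy.ratio (π i) β : IVPolicy.Sample 𝒳 𝒵 𝒜 → ℝ)))
    -- the policy-independent rate and the approximation error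
    (r ε : ℕ → ℝ) (V : ι → ℝ)
    (hr : ∀ n, 1 ≤ n → 0 < r n)
    (hε : Tendsto ε atTop (𝓝 0))
    (hV : ∀ i n, 1 ≤ n → |r n * IVPolicy.loss env Q f θ₀ est (π i) n - V i| ≤ ε n)
    (hα : ∀ i, (fun n => r n * IVPolicy.lossL2 env Q f θ₀ est (π i) n)
      =O[atTop] (fun _ => (1 : ℝ)))
    (hαβ : (fun n => r n * IVPolicy.lossL2 env Q f θ₀ est β n) =O[atTop] (fun _ => (1 : ℝ)))
    -- the sub-sample size, the number of held-out samples and the number of random subsets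
    (v : IVPolicy.RSVariant) (k M B : ℕ → ℕ)
    (hk : Tendsto k atTop atTop)
    (hkn : Tendsto (fun n => (k n : ℝ) / n) atTop (𝓝 0))
    (hrk : Tendsto (fun n => r (k n) ^ 2 / r n) atTop (𝓝 0))
    (hM : (fun n : ℕ => (n : ℝ) * r (k n) ^ 2 / k n) =O[atTop] (fun n : ℕ => (M n : ℝ)))
    (hB : v = .incomplete → (fun n : ℕ => (n : ℝ) / k n) =O[atTop] (fun n : ℕ => (B n : ℝ)))
    -- for each sample size, runs for all the candidates on one probability space, coupled
    -- arbitrarily (for instance with the same logged data)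
    {Ω : ℕ → Type*} [∀ n, MeasurableSpace (Ω n)] (P : ∀ n, Measure (Ω n))
    [∀ n, IsProbabilityMeasure (P n)]
    (R : ∀ (i : ι) (n : ℕ), IVPolicy.RSRun env Q β (π i) n (k n) (M n) (B n) (P n)) :
    let L : ι → ℕ → ℝ := fun i n => IVPolicy.loss env Q f θ₀ est (π i) n
    let mseRS : ∀ (_ : ι) (n : ℕ), Ω n → ℝ := fun i n ω => (R i n).estimate f est v ω
    let Vhat : ∀ (_ : ι) (n : ℕ), Ω n → ℝ := fun i n ω => r (k n) * mseRS i n ω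
    ∃ C : ι → ℝ, (∀ i, 0 < C i) ∧
      let γ : ι → ℕ → ℝ := fun i n =>
        C i * IVPolicy.errorRate r ε k (IVPolicy.ratioMax 𝒜 (π i) β) n
      -- mean-square consistency, for each fixed policy
      (∀ i,
        (∀ n, MemLp (Vhat i n) 2 (P n)) ∧
        (∀ᶠ n in atTop,
          ∫ ω, (Vhat i n ω - V i) ^ 2 ∂(P n) ≤
              2 * ε (k n) ^ 2 + 2 * r (k n) ^ 2 * ∫ ω, (mseRS i n ω - L i (k n)) ^ 2 ∂(P n) ∧
          2 * ε (k n) ^ 2 + 2 * r (k n) ^ 2 * ∫ ω, (mseRS i n ω - L i (k n)) ^ 2 ∂(P n) ≤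
              γ i n) ∧
        Tendsto (γ i) atTop (𝓝 0) ∧
        Tendsto (fun n => ∫ ω, (Vhat i n ω - V i) ^ 2 ∂(P n)) atTop (𝓝 0)) ∧
      -- near-optimality of the policy with the smaller estimate
      (∀ i j,
        (∀ n, 1 ≤ n → ∀ ω, Vhat i n ω < Vhat j n ω →
          r n * (L i n - L j n) ≤ 2 * (ε n + max |V i - Vhat i n ω| |V j - Vhat j n ω|)) ∧
        (∀ᶠ n in atTop, ∀ δ : ℝ, 0 < δ → δ < 1 →
          1 - δ ≤ (P n).real {ω |
            |V i - Vhat i n ω| ≤ 2 / δ * √(max (γ i n) (γ j n)) ∧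
            |V j - Vhat j n ω| ≤ 2 / δ * √(max (γ i n) (γ j n)) ∧
            (Vhat i n ω < Vhat j n ω →
              r n * (L i n - L j n) ≤
                2 * (ε n + 2 / δ * √(max (γ i n) (γ j n))))})) := by
  intro L mseRS Vhat
  obtain ⟨K, hf⟩ := hf_bdd
  choose C hC0 hC using fun i => IVPolicy.exists_eventually_le_errorRate (ε := ε) hf hf_meas
    hest_meas (hsupp i) (hρ i) hr (hα i) hαβ hk hkn hM hB (R i)
  refine ⟨C, hC0, ?_⟩
  intro γ
  have hρ0 : ∀ i, 0 < IVPolicy.ratioMax 𝒜 (π i) β := fun i =>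
    one_pos.trans_le (IVPolicy.one_le_ratioMax env (hsupp i) (hρ i))
  have hVhat : ∀ i n, MemLp (Vhat i n) 2 (P n) := fun i n =>
    ((R i n).memLp_estimate hf hest_meas v).const_mul _
  have hdev : ∀ i n, MemLp (fun ω => Vhat i n ω - V i) 2 (P n) := fun i n =>
    (hVhat i n).sub (memLp_const _)
  have hγ0 : ∀ i, Tendsto (γ i) atTop (𝓝 0) := fun i => by
    simpa using (IVPolicy.tendsto_errorRate (hρ0 i) hε hk hkn hrk).const_mul (C i)
  have hfirst : ∀ i n, 1 ≤ k n → ∫ ω, (Vhat i n ω - V i) ^ 2 ∂(P n) ≤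
      2 * ε (k n) ^ 2 + 2 * r (k n) ^ 2 * ∫ ω, (mseRS i n ω - L i (k n)) ^ 2 ∂(P n) := by
    intro i n hkn1
    have hint : Integrable (fun ω => (mseRS i n ω - L i (k n)) ^ 2) (P n) :=
      (((R i n).memLp_estimate hf hest_meas v).sub (memLp_const _)).integrable_sq
    have hbias : (r (k n) * L i (k n) - V i) ^ 2 ≤ ε (k n) ^ 2 := by
      rw [← sq_abs]
      exact pow_le_pow_left₀ (abs_nonneg _) (hV i (k n) hkn1) 2
    calc ∫ ω, (Vhat i n ω - V i) ^ 2 ∂(P n)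
        ≤ ∫ ω, (2 * ε (k n) ^ 2 + 2 * r (k n) ^ 2 * (mseRS i n ω - L i (k n)) ^ 2) ∂(P n) := by
          refine integral_mono (hdev i n).integrable_sq
            ((integrable_const _).add (hint.const_mul _)) fun ω => ?_
          have h := add_sq_le (a := r (k n) * L i (k n) - V i)
            (b := r (k n) * (mseRS i n ω - L i (k n)))
          have h' : r (k n) * L i (k n) - V i + r (k n) * (mseRS i n ω - L i (k n)) =
              Vhat i n ω - V i := by simp only [Vhat]; ring
          rw [h', mul_pow] at h
          linarith
      _ = _ := by
          rw [integral_add (integrable_const _) (hint.const_mul _),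
            integral_const_mul (2 * r (k n) ^ 2)]
          simp
  have hrate : ∀ i, ∀ᶠ n in atTop, ∫ ω, (Vhat i n ω - V i) ^ 2 ∂(P n) ≤ γ i n := fun i => by
    filter_upwards [hC i, hk.eventually_ge_atTop 1] with n h1 h2
    exact (hfirst i n h2).trans h1
  have horder : ∀ i j n, 1 ≤ n → ∀ ω, Vhat i n ω < Vhat j n ω →
      r n * (L i n - L j n) ≤ 2 * (ε n + max |V i - Vhat i n ω| |V j - Vhat j n ω|) := by
    intro i j n hn ω hlt
    have hi := abs_le.1 (hV i n hn)
    have hj := abs_le.1 (hV j n hn)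
    have h1 := (le_abs_self (V i - Vhat i n ω)).trans (le_max_left _ |V j - Vhat j n ω|)
    have h2 := (neg_abs_le (V j - Vhat j n ω))
    have h3 := le_max_right |V i - Vhat i n ω| |V j - Vhat j n ω|
    have h4 : r n * (L i n - L j n) = (r n * L i n - V i) - (r n * L j n - V j) + (V i - V j) := by
      ring
    rw [h4]
    linarith [hi.2, hj.1]
  refine ⟨fun i => ⟨hVhat i, ?_, hγ0 i, ?_⟩, fun i j => ⟨horder i j, ?_⟩⟩
  · filter_upwards [hC i, hk.eventually_ge_atTop 1] with n h1 h2
    exact ⟨hfirst i n h2, h1⟩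
  · exact tendsto_of_tendsto_of_tendsto_of_le_of_le' tendsto_const_nhds (hγ0 i)
      (Eventually.of_forall fun n => integral_nonneg fun _ => sq_nonneg _) (hrate i)
  · filter_upwards [hrate i, hrate j, eventually_ge_atTop 1] with n h1 h2 hn δ hδ0 hδ1
    set g := max (γ i n) (γ j n)
    have hgpos : 0 < g :=
      (mul_pos (hC0 i) (IVPolicy.errorRate_pos (hr n hn))).trans_le (le_max_left _ _)
    have hi := IVPolicy.measureReal_two_div_mul_sqrt_lt_abs_le (hdev i n) hgpos
      (h1.trans (le_max_left _ _)) hδ0 hδ1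
    have hj := IVPolicy.measureReal_two_div_mul_sqrt_lt_abs_le (hdev j n) hgpos
      (h2.trans (le_max_right _ _)) hδ0 hδ1
    set E := {ω | |V i - Vhat i n ω| ≤ 2 / δ * √g ∧ |V j - Vhat j n ω| ≤ 2 / δ * √g ∧
      (Vhat i n ω < Vhat j n ω → r n * (L i n - L j n) ≤ 2 * (ε n + 2 / δ * √g))}
    have hcover : Set.univ ⊆ E ∪ ({ω | 2 / δ * √g < |Vhat i n ω - V i|} ∪
        {ω | 2 / δ * √g < |Vhat j n ω - V j|}) := by
      intro ω _
      by_cases hi' : 2 / δ * √g < |Vhat i n ω - V i|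
      · exact Or.inr (Or.inl hi')
      by_cases hj' : 2 / δ * √g < |Vhat j n ω - V j|
      · exact Or.inr (Or.inr hj')
      rw [not_lt, abs_sub_comm] at hi' hj'
      refine Or.inl ⟨hi', hj', fun hlt => (horder i j n hn ω hlt).trans ?_⟩
      have := max_le hi' hj'
      linarith
    have hmeas := (measureReal_mono (μ := P n) hcover).trans (measureReal_union_le _ _)
    have hunion := measureReal_union_le (μ := P n) {ω | 2 / δ * √g < |Vhat i n ω - V i|}
        {ω | 2 / δ * √g < |Vhat j n ω - V j|}
    rw [probReal_univ] at hmeas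
    linarith
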